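/- **Setting.** Let $N\ge 1$, $0<\alpha<N$, and let $\mathbb{Z}^N$ be the integer lattice graph ($x\sim y$ iff $\sum_i|x_i-y_i|=1$). Let $k_t(x,y)=(e^{t\Delta}\delta_y)(x)$ be the heat kernel of the discrete Laplacian $\Delta u(x)=\sum_{y\sim x}(u(y)-u(x))$, let $$R_\alpha(x,y)=\frac{1}{\Gamma(\alpha/2)}\int_0^\infty k_t(x,y)\,t^{\alpha/2-1}\,dt$$ be the Green's function of the discrete fractional Laplacian $(-\Delta)^{\alpha/2}$, and write $(R_\alpha*f)(x)=\sum_{y\in\mathbb{Z}^N}R_\alpha(x,y)f(y)$. Let $a,b:\mathbb{Z}^N\to[0,\infty)$, $\gamma\in\mathbb{R}$ and $F:\mathbb{R}^2\to[0,\infty)$ satisfy: * $(A_1)$ the sets $\{a=0\}$, $\{b=0\}$ and $\{a=0\}\cap\{b=0\}$ are non-empty and bounded; * $(A_2')$ there are $M_1,M_2>0$ such that $\{x:a(x)\le M_1\}$ and $\{x:b(x)\le M_2\}$ are finite and non-empty; * $(F_1)$ $F$ is of class $C^1$, not identically zero, and $F(tu,tv)=t^\gamma F(u,v)$ for all $t>0$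 and $(u,v)\in\mathbb{R}^2$. For $p\ge2$, $\lambda>0$ and $h\ge0$ put $|\nabla u|^p(x)=\frac12\sum_{y\sim x}|u(y)-u(x)|^p$, let $W^{1,p}$ be the space of $u:\mathbb{Z}^N\to\mathbb{R}$ with $\sum_x(|\nabla u|^p+|u|^p)<\infty$, and let $W_{\lambda,h}$ be the space of $u\in W^{1,p}$ with $\sum_x(\lambda h+1)|u|^p<\infty$, normed by $\|u\|_{\lambda,h}=\big(\sum_x(|\nabla u|^p+(\lambda h+1)|u|^p)\big)^{1/p}$. Let $W_\lambda=W_{\lambda,a}\times W_{\lambda,b}$ with $\|(u,v)\|_\lambda=(\|u\|_{\lambda,a}^p+\|v\|_{\lambda,b}^p)^{1/p}$, and $$J_\lambda(u,v)=\frac1p\|(u,v)\|_\lambda^p-\frac1{2\gamma}\sum_{x\in\mathbb{Z}^N}\big(R_\alpha*F(u,v)\big)(x)\,F(u(x),v(x)),$$ $$\mathcal N_\lambda=\{(u,v)\in W_\lambda\setminus\{(0,0)\}:\langle J_\lambda'(u,v),(u,v)\rangle=0\},$$ where $J_\lambda'$ is the Fréchet derivative. With $\Delta_pu(x)=\sum_{y\sim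 x}|u(y)-u(x)|^{p-2}(u(y)-u(x))$, $J_\lambda$ is the energy functional of the system $$\begin{cases}-\Delta_pu+(\lambda a+1)|u|^{p-2}u=\frac1\gamma(R_\alpha*F(u,v))F_u(u,v),\\-\Delta_pv+(\lambda b+1)|v|^{p-2}v=\frac1\gamma(R_\alpha*F(u,v))F_v(u,v)\end{cases}\quad\text{on }\mathbb{Z}^N;$$ a *ground state solution* of the system is a $(u,v)\in W_\lambda\setminus\{(0,0)\}$ with $J_\lambda'(u,v)=0$ and $J_\lambda(u,v)=\inf_{\mathcal N_\lambda}J_\lambda$. **Theorem 1.1.** Under these assumptions there is $\lambda_0>0$ such that for every $\lambda\ge\lambda_0$ and every $p\ge2$ with $\gamma>\frac{(N+\alpha)p}{2N}$ the system has a ground state solution. -/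

import Mathlib

open scoped NNReal ENNReal

noncomputable section

namespace Choquard

/-- The vertex set of the `N`-dimensional integer lattice graph. -/
abbrev LatticePoint (N : ℕ) : Type := Fin N → ℤ

variable {N : ℕ}

/-- The neighbours of `x`: all lattice points `y` with `∑ i, |x i - y i| = 1`
(every such `y` lies in the box `[x - 1, x + 1]`, see `mem_neighbors`). -/
def neighbors (x : LatticePoint N) : Finset (LatticePoint N) :=
  (Finset.Icc (x - 1) (x + 1)).filter fun y => ∑ i, |x i - y i| = 1

theorem mem_neighbors {x y : LatticePoint N} : y ∈ neighbors x ↔ ∑ i, |x i - y i| = 1 := by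
  unfold neighbors
  rw [Finset.mem_filter, and_iff_right_iff_imp]
  intro h
  have key : ∀ i, |x i - y i| ≤ 1 := fun i => by
    rw [← h]
    exact Finset.single_le_sum (f := fun i => |x i - y i|) (fun j _ => abs_nonneg _)
      (Finset.mem_univ i)
  rw [Finset.mem_Icc]
  constructor <;> intro i <;> have := abs_le.1 (key i) <;> simp <;> omega

theorem self_notMem_neighbors (x : LatticePoint N) : x ∉ neighbors x := by
  simp [mem_neighbors]

/-- The discrete Laplacian `Δ u (x) = ∑_{y ∼ x} (u y - u x)`. -/
def laplacian (u : LatticePoint N → ℝ) (x : LatticePoint N) : ℝ :=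
  ∑ y ∈ neighbors x, (u y - u x)

/-- The heat kernel `k_t(x, y) = (e^{tΔ} δ_y)(x)` of the discrete Laplacian. Since
`|(Δ^n δ_y)(x)| ≤ (4N)^n`, the exponential series converges absolutely. -/
def heatKernel (t : ℝ) (x y : LatticePoint N) : ℝ :=
  ∑' n : ℕ, t ^ n / (n.factorial : ℝ) * (laplacian^[n] (Pi.single y (1 : ℝ))) x

/-- The Green's function of the discrete fractional Laplacian `(-Δ)^{α/2}`, namely
`R_α(x, y) = Γ(α/2)⁻¹ ∫_0^∞ k_t(x, y) t^{α/2 - 1} dt`; it behaves like `|x - y|^{α - N}`. -/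
def green (α : ℝ) (x y : LatticePoint N) : ℝ :=
  (Real.Gamma (α / 2))⁻¹ * ∫ t in Set.Ioi (0 : ℝ), heatKernel t x y * t ^ (α / 2 - 1)

/-- The convolution `(R_α ∗ f)(x) = ∑_y R_α(x, y) f(y)`. -/
def greenConv (α : ℝ) (f : LatticePoint N → ℝ) (x : LatticePoint N) : ℝ :=
  ∑' y, green α x y * f y

/-- The `p`-th power `|∇u|^p (x) = ½ ∑_{y ∼ x} |u y - u x|^p` of the length of the gradient. -/
def gradPow (p : ℝ) (u : LatticePoint N → ℝ) (x : LatticePoint N) : ℝ :=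
  1 / 2 * ∑ y ∈ neighbors x, |u y - u x| ^ p

/-- `u` has finite `W^{1,p}` norm. On the lattice these are exactly the functions in `ℓ^p`, and
`C_c` is dense in them, so this describes the completion of `C_c` in the `W^{1,p}` norm. -/
def MemW1p (p : ℝ) (u : LatticePoint N → ℝ) : Prop :=
  Summable fun x => gradPow p u x + |u x| ^ p

/-- The density `|∇u|^p + (λ h + 1) |u|^p` of the norm of `W_{λ,h}`. -/
def energyDensity (p : ℝ) (lam : ℝ≥0) (h : LatticePoint N → ℝ≥0) (u : LatticePoint N → ℝ)
    (x : LatticePoint N) : ℝ :=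
  gradPow p u x + ((lam : ℝ) * h x + 1) * |u x| ^ p

section Space

variable (p : ℝ) (lam : ℝ≥0) (h : LatticePoint N → ℝ≥0)

theorem gradPow_nonneg (u : LatticePoint N → ℝ) (x : LatticePoint N) : 0 ≤ gradPow p u x := by
  unfold gradPow
  positivity

theorem energyDensity_nonneg (u : LatticePoint N → ℝ) (x : LatticePoint N) :
    0 ≤ energyDensity p lam h u x := by
  have := gradPow_nonneg p u x
  unfold energyDensity
  positivity

/-- Minkowski's inequality for the local (single vertex) norms. -/
theorem energyDensity_add_le (hp : 1 ≤ p) (u v : LatticePoint N → ℝ) (x : LatticePoint N) :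
    energyDensity p lam h (u + v) x ^ (1 / p) ≤
      energyDensity p lam h u x ^ (1 / p) + energyDensity p lam h v x ^ (1 / p) := by
  have hp0 : p ≠ 0 := by linarith
  let c : (LatticePoint N → ℝ) → LatticePoint N → ℝ := fun u y =>
    if y = x then ((lam : ℝ) * h x + 1) ^ (1 / p) * u x else (1 / 2 : ℝ) ^ (1 / p) * (u y - u x)
  have hc : ∀ u, energyDensity p lam h u x = ∑ y ∈ insert x (neighbors x), |c u y| ^ p := by
    intro u
    rw [Finset.sum_insert (self_notMem_neighbors x), energyDensity, gradPow, add_comm,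
      Finset.mul_sum]
    congr 1
    · have hw : (0 : ℝ) ≤ (lam : ℝ) * h x + 1 := by positivity
      simp only [c, if_true]
      rw [abs_mul, Real.mul_rpow (abs_nonneg _) (abs_nonneg _),
        abs_of_nonneg (Real.rpow_nonneg hw _), ← Real.rpow_mul hw, one_div_mul_cancel hp0,
        Real.rpow_one]
    · refine Finset.sum_congr rfl fun y hy => ?_
      have hyx : y ≠ x := fun e => self_notMem_neighbors x (e ▸ hy)
      simp only [c, if_neg hyx]
      rw [abs_mul, Real.mul_rpow (abs_nonneg _) (abs_nonneg _),
        abs_of_nonneg (Real.rpow_nonneg (by norm_num) _), ← Real.rpow_mul (by norm_num),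
        one_div_mul_cancel hp0, Real.rpow_one]
  have hadd : ∀ y, c (u + v) y = c u y + c v y := by
    intro y
    simp only [c, Pi.add_apply]
    split_ifs <;> ring
  rw [hc, hc, hc]
  simp only [hadd]
  exact Real.Lp_add_le _ _ _ hp

theorem energyDensity_smul (r : ℝ) (u : LatticePoint N → ℝ) (x : LatticePoint N) :
    energyDensity p lam h (r • u) x = |r| ^ p * energyDensity p lam h u x := by
  have : ∀ s : ℝ, |r * s| ^ p = |r| ^ p * |s| ^ p := fun s => by
    rw [abs_mul, Real.mul_rpow (abs_nonneg _) (abs_nonneg _)]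
  simp only [energyDensity, gradPow, Pi.smul_apply, smul_eq_mul, ← mul_sub, this,
    ← Finset.mul_sum]
  ring

theorem energyDensity_rpow (hp : 1 ≤ p) (u : LatticePoint N → ℝ) (x : LatticePoint N) :
    (energyDensity p lam h u x ^ (1 / p)) ^ p = energyDensity p lam h u x := by
  rw [← Real.rpow_mul (energyDensity_nonneg p lam h u x), one_div_mul_cancel (by linarith),
    Real.rpow_one]

/-- Summability and Minkowski's inequality for the global norms. -/
theorem energy_add (hp : 1 ≤ p) {u v : LatticePoint N → ℝ} (hu : Summable (energyDensity p lam h u))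
    (hv : Summable (energyDensity p lam h v)) :
    Summable (energyDensity p lam h (u + v)) ∧
      (∑' x, energyDensity p lam h (u + v) x) ^ (1 / p) ≤
        (∑' x, energyDensity p lam h u x) ^ (1 / p) +
          (∑' x, energyDensity p lam h v x) ^ (1 / p) := by
  have e := energyDensity_rpow p lam h hp (N := N)
  have nn := energyDensity_nonneg p lam h (N := N)
  obtain ⟨h1, h2⟩ := Real.Lp_add_le_tsum_of_nonneg hp
    (f := fun x => energyDensity p lam h u x ^ (1 / p))
    (g := fun x => energyDensity p lam h v x ^ (1 / p))
    (fun x => Real.rpow_nonneg (nn u x) _) (fun x => Real.rpow_nonneg (nn v x) _)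
    (by simpa only [e] using hu) (by simpa only [e] using hv)
  have le : ∀ x, energyDensity p lam h (u + v) x ≤
      (energyDensity p lam h u x ^ (1 / p) + energyDensity p lam h v x ^ (1 / p)) ^ p := by
    intro x
    rw [← e (u + v) x]
    exact Real.rpow_le_rpow (Real.rpow_nonneg (nn _ x) _) (energyDensity_add_le p lam h hp u v x)
      (by linarith)
  have hs : Summable (energyDensity p lam h (u + v)) :=
    Summable.of_nonneg_of_le (nn _) le h1
  refine ⟨hs, ?_⟩
  simp only [e] at h2
  refine le_trans (Real.rpow_le_rpow (tsum_nonneg (nn _)) (hs.tsum_le_tsum le h1) ?_) h2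
  have : 0 ≤ p := by linarith
  positivity

theorem energyDensity_zero (hp : 1 ≤ p) (x : LatticePoint N) :
    energyDensity p lam h (0 : LatticePoint N → ℝ) x = 0 := by
  have hp0 : p ≠ 0 := by linarith
  simp [energyDensity, gradPow, Real.zero_rpow hp0]

theorem memW1p_iff {u : LatticePoint N → ℝ} :
    MemW1p p u ↔ Summable (energyDensity p 0 (0 : LatticePoint N → ℝ≥0) u) := by
  have e : energyDensity p 0 (0 : LatticePoint N → ℝ≥0) u = fun x => gradPow p u x + |u x| ^ p := by
    funext x
    simp [energyDensity]
  rw [e, MemW1p]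

theorem summable_energyDensity {u : LatticePoint N → ℝ} (h1 : MemW1p p u)
    (h2 : Summable fun x => ((lam : ℝ) * h x + 1) * |u x| ^ p) :
    Summable (energyDensity p lam h u) := by
  refine Summable.of_nonneg_of_le (energyDensity_nonneg p lam h u) (fun x => ?_) (h1.add h2)
  have : 0 ≤ |u x| ^ p := by positivity
  unfold energyDensity
  linarith

theorem summable_of_energyDensity {u : LatticePoint N → ℝ}
    (hu : Summable (energyDensity p lam h u)) :
    Summable fun x => ((lam : ℝ) * h x + 1) * |u x| ^ p := by
  refine Summable.of_nonneg_of_le (fun x => by positivity) (fun x => ?_) hu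
  have := gradPow_nonneg p u x
  unfold energyDensity
  linarith

variable [hp : Fact (2 ≤ p)]

/-- The subspace `W_{λ,h} = {u ∈ W^{1,p} : ∑ (λ h + 1) |u|^p < ∞}` of `W^{1,p}`. -/
def weightedSubmodule : Submodule ℝ (LatticePoint N → ℝ) where
  carrier := {u | MemW1p p u ∧ Summable fun x => ((lam : ℝ) * h x + 1) * |u x| ^ p}
  zero_mem' := by
    have hp0 : p ≠ 0 := by linarith [hp.out]
    simp [MemW1p, gradPow, Real.zero_rpow hp0, summable_zero]
  add_mem' := by
    rintro u v ⟨hu, hu'⟩ ⟨hv, hv'⟩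
    have h1 : 1 ≤ p := by linarith [hp.out]
    refine ⟨(memW1p_iff p).2 (energy_add p _ _ h1 ((memW1p_iff p).1 hu) ((memW1p_iff p).1 hv)).1, ?_⟩
    exact summable_of_energyDensity p lam h (energy_add p _ _ h1
      (summable_energyDensity p lam h hu hu') (summable_energyDensity p lam h hv hv')).1
  smul_mem' := by
    rintro r u ⟨hu, hu'⟩
    have h1 : 1 ≤ p := by linarith [hp.out]
    refine ⟨(memW1p_iff p).2 ?_, summable_of_energyDensity p lam h ?_⟩
    · rw [funext (energyDensity_smul p 0 0 r u)]
      exact ((memW1p_iff p).1 hu).mul_left _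
    · rw [funext (energyDensity_smul p lam h r u)]
      exact (summable_energyDensity p lam h hu hu').mul_left _

/-- The space `W_{λ,h}`, to be equipped with its own norm (and not with the topology of pointwise
convergence). -/
def WeightedSpace : Type := ↥(weightedSubmodule p lam h)

instance : AddCommGroup (WeightedSpace p lam h) :=
  inferInstanceAs (AddCommGroup ↥(weightedSubmodule p lam h))

instance : Module ℝ (WeightedSpace p lam h) :=
  inferInstanceAs (Module ℝ ↥(weightedSubmodule p lam h))

variable {p lam h}

/-- The underlying function of an element of `W_{λ,h}`. -/
def WeightedSpace.fn (u : WeightedSpace p lam h) : LatticePoint N → ℝ := Subtype.val u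

instance : CoeFun (WeightedSpace p lam h) fun _ => LatticePoint N → ℝ := ⟨WeightedSpace.fn⟩

theorem WeightedSpace.summable (u : WeightedSpace p lam h) :
    Summable (energyDensity p lam h u.fn) :=
  summable_energyDensity p lam h u.2.1 u.2.2

variable (p lam h)

/-- `‖u‖_{λ,h} = (∑ (|∇u|^p + (λ h + 1) |u|^p))^{1/p}`. -/
instance : Norm (WeightedSpace p lam h) :=
  ⟨fun u => (∑' x, energyDensity p lam h u.fn x) ^ (1 / p)⟩

theorem weightedSpace_core : NormedSpace.Core ℝ (WeightedSpace p lam h) where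
  norm_nonneg u := Real.rpow_nonneg (tsum_nonneg (energyDensity_nonneg p lam h u.fn)) _
  norm_smul r u := by
    have h1 : 1 ≤ p := by linarith [hp.out]
    have e : (r • u).fn = r • u.fn := rfl
    change (∑' x, energyDensity p lam h (r • u).fn x) ^ (1 / p) =
      ‖r‖ * (∑' x, energyDensity p lam h u.fn x) ^ (1 / p)
    rw [e, funext (energyDensity_smul p lam h r u.fn), tsum_mul_left,
      Real.mul_rpow (by positivity) (tsum_nonneg (energyDensity_nonneg p lam h u.fn)),
      ← Real.rpow_mul (abs_nonneg r), mul_one_div_cancel (by linarith), Real.rpow_one,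
      Real.norm_eq_abs]
  norm_triangle u v :=
    (energy_add p lam h (by linarith [hp.out]) u.summable v.summable).2
  norm_eq_zero_iff u := by
    have h1 : 1 ≤ p := by linarith [hp.out]
    have nn := energyDensity_nonneg p lam h u.fn
    have hp0 : 1 / p ≠ 0 := by
      have : p ≠ 0 := by linarith
      positivity
    change (∑' x, energyDensity p lam h u.fn x) ^ (1 / p) = 0 ↔ u = 0
    rw [Real.rpow_eq_zero (tsum_nonneg nn) hp0]
    constructor
    · intro h0
      have hz := (hasSum_zero_iff_of_nonneg nn).1 (h0 ▸ u.summable.hasSum)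
      refine Subtype.ext (funext fun x => ?_)
      have hx : energyDensity p lam h u.fn x = 0 := congrFun hz x
      by_contra hne
      have hpos : 0 < |u.fn x| ^ p := Real.rpow_pos_of_pos (abs_pos.2 hne) _
      have hw : (0 : ℝ) < (lam : ℝ) * h x + 1 := by positivity
      have := gradPow_nonneg p u.fn x
      have := mul_pos hw hpos
      unfold energyDensity at hx
      linarith
    · rintro rfl
      have e : (0 : WeightedSpace p lam h).fn = 0 := rfl
      rw [e, funext (energyDensity_zero p lam h h1), tsum_zero]

instance : NormedAddCommGroup (WeightedSpace p lam h) :=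
  NormedAddCommGroup.ofCore (weightedSpace_core p lam h)

instance : NormedSpace ℝ (WeightedSpace p lam h) :=
  NormedSpace.ofCore (weightedSpace_core p lam h)

instance fact_one_le_ofReal : Fact (1 ≤ ENNReal.ofReal p) :=
  ⟨by rw [ENNReal.one_le_ofReal]; linarith [hp.out]⟩

variable (a b : LatticePoint N → ℝ≥0)

/-- The product `W_λ = W_{λ,a} × W_{λ,b}` with the norm
`‖(u, v)‖_λ = (‖u‖_{λ,a}^p + ‖v‖_{λ,b}^p)^{1/p}`. -/
abbrev PairSpace : Type :=
  WithLp (ENNReal.ofReal p) (WeightedSpace p lam a × WeightedSpace p lam b)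

variable {p lam a b}

/-- The energy functional
`J_λ(u, v) = (1/p) ‖(u, v)‖_λ^p - (1/(2γ)) ∑ (R_α ∗ F(u, v)) F(u, v)`. -/
def energy (α γ : ℝ) (F : ℝ × ℝ → ℝ) (z : PairSpace p lam a b) : ℝ :=
  1 / p * ‖z‖ ^ p -
    1 / (2 * γ) * ∑' x, greenConv α (fun y => F (z.fst y, z.snd y)) x * F (z.fst x, z.snd x)

variable (p lam a b)

/-- The Nehari manifold: all `z ≠ 0` in `W_λ` with `⟨J_λ'(z), z⟩ = 0`, where `J_λ'(z)` is the
Fréchet derivative. -/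
def nehari (α γ : ℝ) (F : ℝ × ℝ → ℝ) : Set (PairSpace p lam a b) :=
  {z | z ≠ 0 ∧ ∃ J' : PairSpace p lam a b →L[ℝ] ℝ, HasFDerivAt (energy α γ F) J' z ∧ J' z = 0}

variable {p lam a b}

/-- `z` is a ground state solution: a nontrivial critical point of `J_λ` whose energy is the
infimum of `J_λ` over the Nehari manifold. (Such a `z` lies on the Nehari manifold, so the infimum
is that of a nonempty set, and it is attained.) -/
def IsGroundState (α γ : ℝ) (F : ℝ × ℝ → ℝ) (z : PairSpace p lam a b) : Prop :=
  z ≠ 0 ∧ HasFDerivAt (energy α γ F) (0 : PairSpace p lam a b →L[ℝ] ℝ) z ∧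
    IsGLB (energy α γ F '' nehari p lam a b α γ F) (energy α γ F z)

end Space

end Choquard

end

noncomputable section

namespace Choquard

/-! ### Neighbours in the lattice -/

section Lattice

variable {N : ℕ}

/-! Put `r = 2N/(N+α)`, so that `1 < r < 2` and the condition on `γ` reads `p < γ r`. The
Hardy–Littlewood–Sobolev inequality makes `D(f, g) = ∑ R_α(x,y) f(x) g(y)` a bounded symmetric form
on `ℓ^r`. Since `W_λ ⊂ ℓ^p ⊂ ℓ^{γr}` and `F ≤ C‖·‖^γ`, the functional `B(z) = D(F(z), F(z))` is well
defined and Fréchet differentiable on `W_λ`, and it is homogeneous of degree `2γ > p`.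

By homogeneity it is enough to maximize `B` on the unit sphere (`exists_groundState_of_maximizer`).
If `S` is the maximum, a suitable multiple of a maximizer is critical for `J_λ`. On the Nehari set
`‖z‖^p = B(z) ≤ S‖z‖^{2γ}`, which bounds `‖z‖` from below, and there `J_λ = (1/p - 1/(2γ))‖z‖^p`, so
this multiple has least energy.

The maximizer comes from `exists_maximizer`. Take a maximizing sequence in the unit ball with
pointwise limit `z₀`, and let `g_n = F(z_n) - F(z₀)`. Then `B(z_n) = B(z₀) + 2D(F(z₀), g_n) + D(g_n,
g_n)`. The middle term vanishes in the limit because `g_n` is weakly null. Only mass escaping from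
finite sets contributes to the last term. Outside a finite set the potential is at least `m`, so the
`ℓ^p` mass there is at most `(1 - ‖z₀‖^p)/m`. For large `m` the last term is at most `(S/2)(1 -
‖z₀‖^p)`, whereas `B(z₀) ≤ S‖z₀‖^p`; together these force `‖z₀‖ = 1` and `B(z₀) = S`.

One `λ₀` serves all `p`, since the smallness condition involves only `‖D‖`, `C` and the energy of a
function supported at one common zero of `a` and `b`, whose norm is at most 1 for every `p` and `λ`.

The Hardy–Littlewood–Sobolev inequality rests on two properties of the heat kernel: it is
sub-Markovian (`sum_heatKernel_le_one`) and it decays like `t^{-N/2}` (`heatKernel_le_rpow`). -/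

theorem sum_abs_single (j : Fin N) (s : ℤ) :
    ∑ i, |(Pi.single j s : LatticePoint N) i| = |s| := by
  rw [Finset.sum_eq_single j]
  · simp
  · intro i _ hij
    simp [Pi.single_eq_of_ne hij]
  · simp

theorem exists_single_of_sum_abs_eq_one {d : LatticePoint N} (h : ∑ i, |d i| = 1) :
    ∃ j, d = Pi.single j 1 ∨ d = Pi.single j (-1) := by
  have hj : ∃ j, d j ≠ 0 := by
    by_contra! hcon
    simp [hcon] at h
  obtain ⟨j, hj⟩ := hj
  have hsum := Finset.add_sum_erase Finset.univ (fun i => |d i|) (Finset.mem_univ j)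
  have hnn : 0 ≤ ∑ i ∈ Finset.univ.erase j, |d i| := Finset.sum_nonneg fun i _ => abs_nonneg _
  have hpos : 0 < |d j| := abs_pos.2 hj
  simp only [h] at hsum
  have hz : ∑ i ∈ Finset.univ.erase j, |d i| = 0 := by omega
  have h1 : |d j| = 1 := by omega
  have hne : ∀ i, i ≠ j → d i = 0 := fun i hi => by
    have := (Finset.sum_eq_zero_iff_of_nonneg fun i _ => abs_nonneg (d i)).1 hz i (by simp [hi])
    simpa using this
  refine ⟨j, ?_⟩
  have key : d = Pi.single j (d j) := by
    ext i
    by_cases hi : i = j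
    · subst hi; simp
    · rw [hne i hi, Pi.single_eq_of_ne hi]
  rcases (abs_eq (by norm_num)).1 h1 with h2 | h2
  · left; rw [key, h2]
  · right; rw [key, h2]

/-- Indexing neighbours by coordinate directions gives the degree `2N`, the reflection symmetry and
the Fourier symbol. -/
theorem sum_neighbors {M : Type*} [AddCommMonoid M] (x : LatticePoint N)
    (g : LatticePoint N → M) :
    ∑ y ∈ neighbors x, g y = ∑ j, (g (x + Pi.single j 1) + g (x - Pi.single j 1)) := by
  have e : ∀ j : Fin N, g (x + Pi.single j 1) + g (x - Pi.single j 1) =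
      ∑ s : Bool, g (x + Pi.single j (if s then 1 else -1)) := by
    intro j
    rw [Fintype.sum_bool]
    simp [sub_eq_add_neg, Pi.single_neg]
  simp only [e]
  refine Eq.trans ?_ (Fintype.sum_prod_type' (fun (j : Fin N) (s : Bool) =>
    g (x + Pi.single j (if s then 1 else -1))))
  symm
  refine Finset.sum_bij (fun a _ => x + Pi.single a.1 (if a.2 then 1 else -1)) ?_ ?_ ?_ ?_
  · rintro ⟨j, s⟩ _
    rw [mem_neighbors]
    have : ∀ i, |x i - (x + Pi.single j (if s then 1 else -1) : LatticePoint N) i| =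
        |(Pi.single j (if s then 1 else -1) : LatticePoint N) i| := fun i => by
      rw [Pi.add_apply, sub_add_cancel_left, abs_neg]
    simp only [this, sum_abs_single]
    cases s <;> simp
  · rintro ⟨j, s⟩ _ ⟨j', s'⟩ _ h
    have h := congrFun (add_left_cancel h) j
    by_cases hj : j = j'
    · subst hj
      cases s <;> cases s' <;> simp at h ⊢
    · rw [Pi.single_eq_same, Pi.single_eq_of_ne hj] at h
      cases s <;> simp at h
  · intro y hy
    rw [mem_neighbors] at hy
    have hy' : ∑ i, |(y - x) i| = 1 := by
      rw [← hy]
      exact Finset.sum_congr rfl fun i _ => by rw [Pi.sub_apply, abs_sub_comm]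
    obtain ⟨j, h | h⟩ := exists_single_of_sum_abs_eq_one hy'
    · exact ⟨(j, true), Finset.mem_univ _, by simp [← h]⟩
    · refine ⟨(j, false), Finset.mem_univ _, ?_⟩
      simp only [Bool.false_eq_true, if_false]
      rw [← h, add_sub_cancel]
  · intro a _
    rfl

theorem card_neighbors (x : LatticePoint N) : (neighbors x).card = 2 * N := by
  have := sum_neighbors x (fun _ => (1 : ℕ))
  simp only [Finset.sum_const, smul_eq_mul, mul_one, Finset.card_univ, Fintype.card_fin] at this
  omega

/-- The point reflection exchanging `x` and `y` is an automorphism of the lattice graph. -/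
theorem sum_neighbors_reflect (c x : LatticePoint N) (g : LatticePoint N → ℝ) :
    ∑ y ∈ neighbors x, g (c - y) = ∑ y ∈ neighbors (c - x), g y := by
  rw [sum_neighbors, sum_neighbors]
  refine Finset.sum_congr rfl fun j _ => ?_
  rw [add_comm, show c - (x - Pi.single j 1) = c - x + Pi.single j 1 by abel,
    show c - (x + Pi.single j 1) = c - x - Pi.single j 1 by abel]

/-! ### Powers of the adjacency operator -/

/-- The adjacency operator of the lattice. -/
def adj : Module.End ℝ (LatticePoint N → ℝ) where
  toFun u x := ∑ y ∈ neighbors x, u y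
  map_add' u v := by ext x; simp [Finset.sum_add_distrib]
  map_smul' r u := by ext x; simp [Finset.mul_sum]

theorem adj_apply (u : LatticePoint N → ℝ) (x : LatticePoint N) :
    adj u x = ∑ y ∈ neighbors x, u y := rfl

/-- The adjacency operator preserves positivity and commutes with the constant `-2N`, so `e^{tΔ} =
e^{-2Nt} e^{t adj}` is a series of nonnegative terms times a scalar. -/
theorem laplacian_eq (u : LatticePoint N → ℝ) :
    laplacian u = (adj + algebraMap ℝ _ (-(2 * N : ℝ)) : Module.End ℝ (LatticePoint N → ℝ)) u := by
  ext x
  simp only [laplacian, Finset.sum_sub_distrib, Finset.sum_const, card_neighbors,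
    LinearMap.add_apply, Pi.add_apply, adj_apply, Module.algebraMap_end_apply, Pi.smul_apply,
    smul_eq_mul, nsmul_eq_mul]
  push_cast
  ring

theorem laplacian_iterate (n : ℕ) (u : LatticePoint N → ℝ) :
    laplacian^[n] u =
      ((adj + algebraMap ℝ _ (-(2 * N : ℝ)) : Module.End ℝ (LatticePoint N → ℝ)) ^ n) u := by
  rw [Module.End.pow_apply]
  congr 1
  funext u
  exact laplacian_eq u

theorem adj_pow_nonneg {u : LatticePoint N → ℝ} (hu : 0 ≤ u) (n : ℕ) : 0 ≤ (adj ^ n) u := by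
  induction n with
  | zero => simpa using hu
  | succ n ih =>
    rw [pow_succ']
    exact fun x => Finset.sum_nonneg fun y _ => ih y

theorem adj_pow_le {u : LatticePoint N → ℝ} (hu : u ≤ 1) (n : ℕ) (x : LatticePoint N) :
    (adj ^ n) u x ≤ (2 * N : ℝ) ^ n := by
  induction n generalizing x with
  | zero => simpa using hu x
  | succ n ih =>
    rw [pow_succ', Module.End.mul_apply, adj_apply]
    refine (Finset.sum_le_card_nsmul _ _ _ fun y _ => ih y).trans_eq ?_
    rw [card_neighbors, nsmul_eq_mul, pow_succ']
    push_cast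
    ring

theorem laplacian_reflect (c : LatticePoint N) (u : LatticePoint N → ℝ) (n : ℕ) :
    laplacian^[n] (fun x => u (c - x)) = fun x => laplacian^[n] u (c - x) := by
  induction n with
  | zero => rfl
  | succ n ih =>
    rw [Function.iterate_succ_apply', Function.iterate_succ_apply', ih]
    ext x
    simp only [laplacian]
    rw [← sum_neighbors_reflect c x (fun y => laplacian^[n] u y - laplacian^[n] u (c - x))]

end Lattice

/-! ### Elementary properties of the heat kernel -/

section Heat

variable {N : ℕ}

theorem heatKernel_symm (t : ℝ) (x y : LatticePoint N) : heatKernel t x y = heatKernel t y x := by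
  unfold heatKernel
  congr 1
  funext n
  congr 1
  -- The reflection `z ↦ x + y - z` exchanges `x` and `y` and commutes with the Laplacian.
  have h : (Pi.single x (1 : ℝ) : LatticePoint N → ℝ) =
      fun z => (Pi.single y (1 : ℝ) : LatticePoint N → ℝ) (x + y - z) := by
    funext z
    simp only [Pi.single_apply]
    congr 1
    simp only [eq_iff_iff]
    constructor
    · rintro rfl; abel
    · intro h
      rw [sub_eq_iff_eq_add] at h
      exact (add_left_cancel ((add_comm y x).trans h)).symm
  rw [h, laplacian_reflect]
  simp

theorem single_nonneg_le_one (y : LatticePoint N) :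
    (0 : LatticePoint N → ℝ) ≤ Pi.single y 1 ∧ (Pi.single y 1 : LatticePoint N → ℝ) ≤ 1 := by
  constructor <;> intro x <;> by_cases h : x = y <;> simp [h]

theorem adj_pow_single_mem (n : ℕ) (x y : LatticePoint N) :
    0 ≤ (adj ^ n) (Pi.single y (1 : ℝ)) x ∧ (adj ^ n) (Pi.single y (1 : ℝ)) x ≤ (2 * N : ℝ) ^ n :=
  ⟨adj_pow_nonneg (single_nonneg_le_one y).1 n x, adj_pow_le (single_nonneg_le_one y).2 n x⟩

theorem summable_adj_series {t : ℝ} (ht : 0 ≤ t) (x y : LatticePoint N) :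
    Summable fun n : ℕ => t ^ n / (n.factorial : ℝ) * (adj ^ n) (Pi.single y (1 : ℝ)) x := by
  refine Summable.of_nonneg_of_le (fun n => ?_) (fun n => ?_)
    (Real.summable_pow_div_factorial (t * (2 * N)))
  · exact mul_nonneg (by positivity) (adj_pow_single_mem n x y).1
  · rw [mul_pow, mul_div_right_comm]
    exact mul_le_mul_of_nonneg_left (adj_pow_single_mem n x y).2 (by positivity)

theorem laplacian_iterate_single (n : ℕ) (x y : LatticePoint N) :
    laplacian^[n] (Pi.single y (1 : ℝ)) x = ∑ m ∈ Finset.HasAntidiagonal.antidiagonal n,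
      (n.choose m.1 : ℝ) * ((adj ^ m.1) (Pi.single y (1 : ℝ)) x * (-(2 * N : ℝ)) ^ m.2) := by
  rw [laplacian_iterate, (Algebra.commute_algebraMap_right (-(2 * N : ℝ)) adj).add_pow']
  rw [LinearMap.sum_apply, Finset.sum_apply]
  refine Finset.sum_congr rfl fun m _ => ?_
  rw [LinearMap.smul_apply, Pi.smul_apply, ← map_pow, ← Algebra.commutes, Module.End.mul_apply,
    Module.algebraMap_end_apply]
  simp only [Pi.smul_apply, smul_eq_mul, nsmul_eq_mul]
  ring

/-- The binomial formula, with `1/n!` distributed over both factors, exhibits the heat kernel as a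
Cauchy product. -/
theorem heatKernel_term (t : ℝ) (n : ℕ) (x y : LatticePoint N) :
    t ^ n / (n.factorial : ℝ) * laplacian^[n] (Pi.single y (1 : ℝ)) x =
      ∑ m ∈ Finset.HasAntidiagonal.antidiagonal n,
        (t ^ m.1 / (m.1.factorial : ℝ) * (adj ^ m.1) (Pi.single y (1 : ℝ)) x) *
          ((-(2 * N * t)) ^ m.2 / (m.2.factorial : ℝ)) := by
  rw [laplacian_iterate_single, Finset.mul_sum]
  refine Finset.sum_congr rfl fun m hm => ?_
  obtain rfl := Finset.HasAntidiagonal.mem_antidiagonal.1 hm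
  have h1 : ((m.1 + m.2).factorial : ℝ) =
      ((m.1 + m.2).choose m.1 : ℝ) * m.1.factorial * m.2.factorial := by
    have := Nat.choose_mul_factorial_mul_factorial (Nat.le_add_right m.1 m.2)
    rw [Nat.add_sub_cancel_left] at this
    exact_mod_cast this.symm
  have h2 : ((m.1 + m.2).choose m.1 : ℝ) ≠ 0 := by
    exact_mod_cast (Nat.choose_pos (Nat.le_add_right m.1 m.2)).ne'
  have h3 : (m.1.factorial : ℝ) ≠ 0 := by positivity
  have h4 : (m.2.factorial : ℝ) ≠ 0 := by positivity
  rw [h1, show (-(2 * (N : ℝ) * t)) ^ m.2 = (-(2 * (N : ℝ))) ^ m.2 * t ^ m.2 by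
    rw [← mul_pow]; congr 1; ring]
  field_simp
  ring

theorem heatKernel_eq {t : ℝ} (ht : 0 ≤ t) (x y : LatticePoint N) :
    heatKernel t x y = (∑' n : ℕ, t ^ n / (n.factorial : ℝ) * (adj ^ n) (Pi.single y (1 : ℝ)) x) *
      Real.exp (-(2 * N * t)) := by
  have h2 : Summable fun n : ℕ => (-(2 * N * t)) ^ n / (n.factorial : ℝ) :=
    Real.summable_pow_div_factorial _
  rw [Real.exp_eq_exp_ℝ, NormedSpace.exp_eq_tsum_div,
    tsum_mul_tsum_eq_tsum_sum_antidiagonal_of_summable_norm (summable_adj_series ht x y).norm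
      h2.norm, heatKernel]
  exact tsum_congr fun n => heatKernel_term t n x y

theorem summable_heatKernel_series {t : ℝ} (ht : 0 ≤ t) (x y : LatticePoint N) :
    Summable fun n : ℕ =>
      t ^ n / (n.factorial : ℝ) * laplacian^[n] (Pi.single y (1 : ℝ)) x := by
  have h2 : Summable fun n : ℕ => (-(2 * N * t)) ^ n / (n.factorial : ℝ) :=
    Real.summable_pow_div_factorial _
  have := (summable_norm_sum_mul_antidiagonal_of_summable_norm (summable_adj_series ht x y).norm
      h2.norm).of_norm
  simpa only [heatKernel_term] using this

theorem heatKernel_nonneg {t : ℝ} (ht : 0 ≤ t) (x y : LatticePoint N) : 0 ≤ heatKernel t x y := by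
  rw [heatKernel_eq ht]
  exact mul_nonneg (tsum_nonneg fun n => mul_nonneg (by positivity) (adj_pow_single_mem n x y).1)
    (Real.exp_nonneg _)

theorem heatKernel_self_pos {t : ℝ} (ht : 0 ≤ t) (x : LatticePoint N) : 0 < heatKernel t x x := by
  rw [heatKernel_eq ht]
  refine mul_pos ?_ (Real.exp_pos _)
  refine (summable_adj_series ht x x).tsum_pos
    (fun n => mul_nonneg (by positivity) (adj_pow_single_mem n x x).1) 0 ?_
  simp

/-- The heat semigroup is sub-Markovian. -/
theorem sum_heatKernel_le_one {t : ℝ} (ht : 0 ≤ t) (x : LatticePoint N)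
    (S : Finset (LatticePoint N)) : ∑ y ∈ S, heatKernel t x y ≤ 1 := by
  simp only [heatKernel_eq ht]
  rw [← Finset.sum_mul, ← Summable.tsum_finsetSum fun y _ => summable_adj_series ht x y]
  -- By linearity the sum over `S` is `adj ^ n` applied to the indicator function of `S`, which is
  -- at most 1.
  have hS : ∀ n : ℕ, ∑ y ∈ S, t ^ n / (n.factorial : ℝ) * (adj ^ n) (Pi.single y (1 : ℝ)) x ≤
      (2 * N * t) ^ n / (n.factorial : ℝ) := by
    intro n
    rw [← Finset.mul_sum]
    have h1 : ∑ y ∈ S, (adj ^ n) (Pi.single y (1 : ℝ)) x =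
        (adj ^ n) (∑ y ∈ S, Pi.single y (1 : ℝ)) x := by
      rw [map_sum, Finset.sum_apply]
    have h2 : (∑ y ∈ S, Pi.single y (1 : ℝ) : LatticePoint N → ℝ) ≤ 1 := by
      intro z
      rw [Finset.sum_apply, Finset.sum_pi_single]
      split_ifs <;> simp
    rw [h1, mul_pow, mul_comm _ (t ^ n), mul_div_right_comm]
    exact mul_le_mul_of_nonneg_left (adj_pow_le h2 n x) (by positivity)
  have hsum : Summable fun n : ℕ =>
      ∑ y ∈ S, t ^ n / (n.factorial : ℝ) * (adj ^ n) (Pi.single y (1 : ℝ)) x :=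
    summable_sum fun y _ => summable_adj_series ht x y
  have hle := hsum.tsum_le_tsum hS (Real.summable_pow_div_factorial _)
  calc _ ≤ (∑' n : ℕ, (2 * N * t) ^ n / (n.factorial : ℝ)) * Real.exp (-(2 * N * t)) :=
        mul_le_mul_of_nonneg_right hle (Real.exp_nonneg _)
    _ = 1 := by
        have : ∑' n : ℕ, (2 * N * t) ^ n / (n.factorial : ℝ) = Real.exp (2 * N * t) := by
          rw [Real.exp_eq_exp_ℝ, NormedSpace.exp_eq_tsum_div]
        rw [this, ← Real.exp_add, add_neg_cancel, Real.exp_zero]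

theorem heatKernel_le_one {t : ℝ} (ht : 0 ≤ t) (x y : LatticePoint N) : heatKernel t x y ≤ 1 := by
  simpa using sum_heatKernel_le_one ht x {y}

theorem aestronglyMeasurable_heatKernel (x y : LatticePoint N) :
    MeasureTheory.AEStronglyMeasurable (fun t => heatKernel t x y)
      (MeasureTheory.volume.restrict (Set.Ioi (0 : ℝ))) := by
  -- For `t > 0` the kernel is the limit of the partial sums, which are polynomials in `t`.
  refine aestronglyMeasurable_of_tendsto_ae Filter.atTop
    (f := fun (n : ℕ) t => ∑ i ∈ Finset.range n,
      t ^ i / (i.factorial : ℝ) * laplacian^[i] (Pi.single y (1 : ℝ)) x) ?_ ?_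
  · intro n
    exact Continuous.aestronglyMeasurable (by fun_prop)
  · filter_upwards [MeasureTheory.ae_restrict_mem measurableSet_Ioi] with t ht
    exact (summable_heatKernel_series (le_of_lt ht) x y).hasSum.tendsto_sum_nat

end Heat

/-! ### Fourier representation and on-diagonal decay of the heat kernel -/

section Fourier

open MeasureTheory Real

variable {N : ℕ}

/-- Lebesgue measure on the cube `(-π, π]^N`. -/
def torusMeasure (N : ℕ) : Measure (Fin N → ℝ) :=
  Measure.pi fun _ => volume.restrict (Set.Ioc (-π) π)

instance : IsFiniteMeasure (torusMeasure N) := by unfold torusMeasure; infer_instance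

/-- The Fourier symbol of the discrete Laplacian. -/
def symbol (θ : Fin N → ℝ) : ℝ := ∑ j, (2 * cos (θ j) - 2)

/-- The phase `⟨x, θ⟩`. -/
def phase (x : LatticePoint N) (θ : Fin N → ℝ) : ℝ := ∑ j, (x j : ℝ) * θ j

theorem continuous_symbol : Continuous (symbol (N := N)) := by
  unfold symbol; fun_prop

theorem continuous_phase (x : LatticePoint N) : Continuous (phase x) := by
  unfold phase; fun_prop

theorem abs_symbol_le (θ : Fin N → ℝ) : |symbol θ| ≤ 4 * N := by
  unfold symbol
  refine (Finset.abs_sum_le_sum_abs _ _).trans ?_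
  refine (Finset.sum_le_card_nsmul _ _ 4 fun j _ => ?_).trans_eq ?_
  · rw [abs_le]
    constructor <;> linarith [neg_one_le_cos (θ j), cos_le_one (θ j)]
  · simp [mul_comm]

theorem integrable_of_bounded_torus {f : (Fin N → ℝ) → ℝ} (hf : Continuous f) {C : ℝ}
    (hC : ∀ θ, |f θ| ≤ C) : Integrable f (torusMeasure N) :=
  Integrable.of_bound hf.aestronglyMeasurable C (Filter.Eventually.of_forall hC)

theorem integrable_symbol_pow_mul_cos (n : ℕ) (x : LatticePoint N) :
    Integrable (fun θ => symbol θ ^ n * cos (phase x θ)) (torusMeasure N) := by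
  refine integrable_of_bounded_torus
    ((continuous_symbol.pow n).mul (continuous_cos.comp (continuous_phase x)))
    (C := (4 * N) ^ n) fun θ => ?_
  rw [abs_mul, abs_pow]
  calc _ ≤ (4 * N : ℝ) ^ n * 1 := by
        gcongr
        · exact abs_symbol_le θ
        · exact abs_cos_le_one _
    _ = _ := mul_one _

theorem integral_exp_int_mul (n : ℤ) :
    ∫ θ in Set.Ioc (-π) π, Complex.exp (Complex.I * n * (θ : ℂ)) =
      if n = 0 then (2 * π : ℂ) else 0 := by
  split_ifs with h
  · subst h
    simp only [Int.cast_zero, mul_zero, zero_mul, Complex.exp_zero, integral_const,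
      measureReal_restrict_apply_univ, volume_real_Ioc]
    rw [max_eq_left (by linarith [pi_pos])]
    simp
    ring
  · have hc : Complex.I * (n : ℂ) ≠ 0 :=
      mul_ne_zero Complex.I_ne_zero (by exact_mod_cast h)
    rw [← intervalIntegral.integral_of_le (by linarith [pi_pos]), integral_exp_mul_complex hc,
      div_eq_zero_iff, sub_eq_zero]
    left
    rw [Complex.exp_eq_exp_iff_exists_int]
    refine ⟨n, ?_⟩
    push_cast
    ring

/-- Orthogonality of characters: the cosine is the real part of a product of one-variable
exponentials, so the integral factorizes. -/
theorem integral_cos_phase (x : LatticePoint N) :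
    ∫ θ, cos (phase x θ) ∂(torusMeasure N) = if x = 0 then (2 * π) ^ N else 0 := by
  have e : ∀ θ : Fin N → ℝ, cos (phase x θ) =
      RCLike.re (∏ j, Complex.exp (Complex.I * (x j : ℂ) * (θ j : ℂ))) := by
    intro θ
    rw [← Complex.exp_sum, ← Complex.exp_ofReal_mul_I_re]
    change _ = Complex.re _
    congr 2
    rw [phase]
    push_cast
    rw [Finset.sum_mul]
    exact Finset.sum_congr rfl fun j _ => by ring
  have hint : Integrable (fun θ : Fin N → ℝ =>
      ∏ j, Complex.exp (Complex.I * (x j : ℂ) * (θ j : ℂ))) (torusMeasure N) := by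
    refine Integrable.fintype_prod (f := fun j (s : ℝ) => Complex.exp (Complex.I * (x j : ℂ) * s))
      fun j => ?_
    exact (Continuous.integrableOn_Ioc (by fun_prop))
  simp only [e]
  rw [integral_re hint, torusMeasure, integral_fintype_prod_eq_prod
    (f := fun j (s : ℝ) => Complex.exp (Complex.I * (x j : ℂ) * s))]
  simp only [integral_exp_int_mul]
  split_ifs with h
  · subst h
    simp only [Pi.zero_apply, if_true, Finset.prod_const, Finset.card_univ, Fintype.card_fin]
    norm_cast
  · obtain ⟨j, hj⟩ := Function.ne_iff.1 h
    rw [Finset.prod_eq_zero (Finset.mem_univ j) (if_neg hj)]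
    simp

theorem phase_add_single (x : LatticePoint N) (j : Fin N) (θ : Fin N → ℝ) :
    phase (x + Pi.single j 1) θ = phase x θ + θ j := by
  simp only [phase, Pi.add_apply, Int.cast_add, add_mul, Finset.sum_add_distrib]
  congr 1
  rw [Finset.sum_eq_single j]
  · simp
  · intro i _ hij
    simp [Pi.single_eq_of_ne hij]
  · simp

theorem phase_sub_single (x : LatticePoint N) (j : Fin N) (θ : Fin N → ℝ) :
    phase (x - Pi.single j 1) θ = phase x θ - θ j := by
  rw [eq_sub_iff_add_eq, ← phase_add_single, sub_add_cancel]

/-- Orthogonality gives the case `n = 0`. Since `cos (A + θ) + cos (A - θ) = 2 cos A cos θ`, each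
Laplacian multiplies the integrand by the symbol. -/
theorem laplacian_iterate_eq_integral (n : ℕ) (x y : LatticePoint N) :
    (2 * π) ^ N * laplacian^[n] (Pi.single y (1 : ℝ)) x =
      ∫ θ, symbol θ ^ n * cos (phase (x - y) θ) ∂(torusMeasure N) := by
  induction n generalizing x with
  | zero =>
    simp only [pow_zero, one_mul, integral_cos_phase, sub_eq_zero, Function.iterate_zero, id,
      Pi.single_apply]
    split_ifs <;> simp
  | succ n ih =>
    rw [Function.iterate_succ_apply']
    simp only [laplacian]
    rw [sum_neighbors, Finset.mul_sum]
    have hstep : ∀ j : Fin N, (2 * π) ^ N *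
        (laplacian^[n] (Pi.single y (1 : ℝ)) (x + Pi.single j 1) -
            laplacian^[n] (Pi.single y (1 : ℝ)) x +
          (laplacian^[n] (Pi.single y (1 : ℝ)) (x - Pi.single j 1) -
            laplacian^[n] (Pi.single y (1 : ℝ)) x)) =
        ∫ θ, (2 * cos (θ j) - 2) * (symbol θ ^ n * cos (phase (x - y) θ)) ∂(torusMeasure N) := by
      intro j
      rw [mul_add, mul_sub, mul_sub, ih, ih, ih,
        ← integral_sub (integrable_symbol_pow_mul_cos _ _) (integrable_symbol_pow_mul_cos _ _),
        ← integral_sub (integrable_symbol_pow_mul_cos _ _) (integrable_symbol_pow_mul_cos _ _)]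
      refine (integral_add
        ((integrable_symbol_pow_mul_cos _ _).sub (integrable_symbol_pow_mul_cos _ _))
        ((integrable_symbol_pow_mul_cos _ _).sub
          (integrable_symbol_pow_mul_cos _ _))).symm.trans (integral_congr_ae
            (Filter.Eventually.of_forall fun θ => ?_))
      simp only [Pi.sub_apply]
      rw [add_sub_right_comm, phase_add_single, sub_right_comm, phase_sub_single, cos_add, cos_sub]
      ring
    rw [Finset.sum_congr rfl fun j _ => hstep j, ← integral_finsetSum]
    · congr 1
      funext θ
      rw [← Finset.sum_mul, pow_succ', mul_assoc]
      rfl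
    · intro j _
      refine integrable_of_bounded_torus
        ((by fun_prop : Continuous fun θ : Fin N → ℝ => 2 * cos (θ j) - 2).mul
          ((continuous_symbol.pow n).mul (continuous_cos.comp (continuous_phase _))))
        (C := 4 * ((4 * N) ^ n * 1)) fun θ => ?_
      rw [abs_mul, abs_mul, abs_pow]
      gcongr
      · rw [abs_le]
        constructor <;> linarith [neg_one_le_cos (θ j), cos_le_one (θ j)]
      · exact abs_symbol_le θ
      · exact abs_cos_le_one _

/-- Summing the exponential series under the integral gives the Fourier formula for the kernel; then
the cosine factor is bounded by 1. -/
theorem heatKernel_le_integral {t : ℝ} (ht : 0 ≤ t) (x y : LatticePoint N) :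
    (2 * π) ^ N * heatKernel t x y ≤ ∫ θ, exp (t * symbol θ) ∂(torusMeasure N) := by
  have hexp : Integrable (fun θ => exp (t * symbol θ)) (torusMeasure N) := by
    refine integrable_of_bounded_torus
      (continuous_exp.comp (continuous_const.mul continuous_symbol)) (C := exp (t * (4 * N)))
      fun θ => ?_
    rw [abs_of_pos (exp_pos _)]
    gcongr
    exact (le_abs_self _).trans (abs_symbol_le θ)
  have hterm : ∀ n : ℕ, (2 * π) ^ N *
      (t ^ n / (n.factorial : ℝ) * laplacian^[n] (Pi.single y (1 : ℝ)) x) =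
      ∫ θ, t ^ n / (n.factorial : ℝ) * (symbol θ ^ n * cos (phase (x - y) θ))
        ∂(torusMeasure N) := by
    intro n
    rw [integral_const_mul, ← laplacian_iterate_eq_integral]
    ring
  have hsum : HasSum (fun n : ℕ => ∫ θ, t ^ n / (n.factorial : ℝ) *
      (symbol θ ^ n * cos (phase (x - y) θ)) ∂(torusMeasure N))
      (∫ θ, ∑' n : ℕ, t ^ n / (n.factorial : ℝ) *
        (symbol θ ^ n * cos (phase (x - y) θ)) ∂(torusMeasure N)) := by
    refine hasSum_integral_of_summable_integral_norm
      (fun n => (integrable_symbol_pow_mul_cos n _).const_mul _) ?_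
    refine Summable.of_nonneg_of_le (fun n => integral_nonneg fun θ => norm_nonneg _) (fun n => ?_)
      ((Real.summable_pow_div_factorial (t * (4 * N))).mul_right
        ((torusMeasure N).real Set.univ))
    refine (integral_mono_of_nonneg (Filter.Eventually.of_forall fun θ => norm_nonneg _)
      (integrable_const ((t * (4 * N)) ^ n / (n.factorial : ℝ)))
      (Filter.Eventually.of_forall fun θ => ?_)).trans_eq ?_
    · simp only
      rw [norm_eq_abs, abs_mul, abs_mul, abs_of_nonneg (by positivity :
        0 ≤ t ^ n / (n.factorial : ℝ)), mul_pow, mul_div_right_comm, abs_pow]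
      refine mul_le_mul_of_nonneg_left ?_ (by positivity)
      calc _ ≤ (4 * N : ℝ) ^ n * 1 := by
            gcongr
            · exact abs_symbol_le θ
            · exact abs_cos_le_one _
        _ = _ := mul_one _
    · rw [integral_const, smul_eq_mul, mul_comm]
  have hpt : ∀ θ : Fin N → ℝ, ∑' n : ℕ, t ^ n / (n.factorial : ℝ) *
      (symbol θ ^ n * cos (phase (x - y) θ)) = exp (t * symbol θ) * cos (phase (x - y) θ) := by
    intro θ
    rw [exp_eq_exp_ℝ, NormedSpace.exp_eq_tsum_div, ← tsum_mul_right]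
    exact tsum_congr fun n => by rw [mul_pow]; ring
  rw [heatKernel, ← tsum_mul_left]
  simp only [hterm]
  rw [hsum.tsum_eq]
  simp only [hpt]
  refine integral_mono ?_ hexp fun θ => mul_le_of_le_one_right (exp_pos _).le (cos_le_one _)
  exact hexp.mono' ((continuous_exp.comp (continuous_const.mul continuous_symbol)).mul
    (continuous_cos.comp (continuous_phase _))).aestronglyMeasurable
    (Filter.Eventually.of_forall fun θ => by
      rw [norm_eq_abs, abs_mul, abs_of_pos (exp_pos _)]
      exact mul_le_of_le_one_right (exp_pos _).le (abs_cos_le_one _))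

/-- On `[-π, π]` one has `cos s ≤ 1 - 2s²/π²`, which leads to a Gaussian integral. The constant `2π`
is not sharp; it is chosen to cancel the factor `(2π)^N` of the Fourier formula. -/
theorem integral_exp_cos_le {t : ℝ} (ht : 0 < t) :
    ∫ s in Set.Ioc (-π) π, exp (t * (2 * cos s - 2)) ≤ 2 * π * t ^ (-(1 / 2) : ℝ) := by
  have hb : 0 < 4 * t / π ^ 2 := by positivity
  calc ∫ s in Set.Ioc (-π) π, exp (t * (2 * cos s - 2))
      ≤ ∫ s in Set.Ioc (-π) π, exp (-(4 * t / π ^ 2) * s ^ 2) := by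
        refine setIntegral_mono_on (Continuous.integrableOn_Ioc (by fun_prop))
          (integrable_exp_neg_mul_sq hb).integrableOn measurableSet_Ioc fun s hs => ?_
        have := cos_le_one_sub_mul_cos_sq (abs_le.2 ⟨hs.1.le, hs.2⟩)
        refine exp_le_exp.2 ?_
        have h2 : t * (2 * cos s - 2) ≤ t * (2 * (1 - 2 / π ^ 2 * s ^ 2) - 2) := by gcongr
        refine h2.trans_eq ?_
        ring
    _ ≤ ∫ s, exp (-(4 * t / π ^ 2) * s ^ 2) :=
        setIntegral_le_integral (integrable_exp_neg_mul_sq hb)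
          (Filter.Eventually.of_forall fun s => (exp_pos _).le)
    _ = √(π / (4 * t / π ^ 2)) := integral_gaussian _
    _ ≤ 2 * π * t ^ (-(1 / 2) : ℝ) := by
        rw [rpow_neg ht.le, ← sqrt_eq_rpow]
        refine sqrt_le_iff.2 ⟨by positivity, ?_⟩
        rw [mul_pow, inv_pow, sq_sqrt ht.le]
        have hpi := pi_le_four
        have : π / (4 * t / π ^ 2) = π ^ 2 * (π / 4) * t⁻¹ := by field_simp
        rw [this]
        have h3 : π ^ 2 * (π / 4) ≤ (2 * π) ^ 2 := by nlinarith [sq_nonneg π]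
        exact mul_le_mul_of_nonneg_right h3 (by positivity)

/-- On-diagonal decay of the heat kernel. -/
theorem heatKernel_le_rpow {t : ℝ} (ht : 0 < t) (x y : LatticePoint N) :
    heatKernel t x y ≤ t ^ (-(N / 2) : ℝ) := by
  have h1 := heatKernel_le_integral ht.le x y
  have h2 : ∫ θ, exp (t * symbol θ) ∂(torusMeasure N) =
      ∏ _j : Fin N, ∫ s in Set.Ioc (-π) π, exp (t * (2 * cos s - 2)) := by
    rw [← integral_fintype_prod_eq_prod (fun (_ : Fin N) (s : ℝ) => exp (t * (2 * cos s - 2)))]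
    simp only [← exp_sum, ← Finset.mul_sum]
    rfl
  rw [h2, Finset.prod_const, Finset.card_univ, Fintype.card_fin] at h1
  have h3 := h1.trans (pow_le_pow_left₀ (setIntegral_nonneg measurableSet_Ioc fun s _ =>
    (exp_pos _).le) (integral_exp_cos_le ht) N)
  rw [mul_pow (2 * π) (t ^ _)] at h3
  refine (le_of_mul_le_mul_left h3 (by positivity)).trans_eq ?_
  rw [← rpow_natCast, ← rpow_mul ht.le]
  congr 1
  ring

end Fourier

/-! ### The Green's function and the Hardy–Littlewood–Sobolev inequality -/

section Green

open MeasureTheory Real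

variable {N : ℕ}

theorem integrableOn_Ioc_rpow_sub_one {β T : ℝ} (hβ : 0 < β) (hT : 0 < T) :
    IntegrableOn (fun t : ℝ => t ^ (β - 1)) (Set.Ioc 0 T) := by
  rw [integrableOn_Ioc_iff_integrableOn_Ioo, intervalIntegral.integrableOn_Ioo_rpow_iff hT]
  linarith

theorem integral_Ioc_rpow_sub_one {β T : ℝ} (hβ : 0 < β) (hT : 0 < T) :
    ∫ t in Set.Ioc 0 T, t ^ (β - 1) = T ^ β / β := by
  rw [← intervalIntegral.integral_of_le hT.le, integral_rpow (Or.inl (by linarith)),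
    sub_add_cancel, zero_rpow hβ.ne', sub_zero]

/-- A function bounded by a constant near zero and by a power at infinity has a finite moment. -/
theorem integrableOn_mul_rpow_and_integral_le {φ : ℝ → ℝ} {β σ h A T : ℝ} (hβ : 0 < β)
    (hσ : β < σ) (hT : 0 < T)
    (hm : AEStronglyMeasurable φ (volume.restrict (Set.Ioi 0))) (h0 : ∀ t, 0 < t → 0 ≤ φ t)
    (h1 : ∀ t, 0 < t → φ t ≤ h) (h2 : ∀ t, 0 < t → φ t ≤ A * t ^ (-σ)) :
    IntegrableOn (fun t => φ t * t ^ (β - 1)) (Set.Ioi 0) ∧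
      ∫ t in Set.Ioi 0, φ t * t ^ (β - 1) ≤ h * (T ^ β / β) + A * (T ^ (β - σ) / (σ - β)) := by
  have hmeas : AEStronglyMeasurable (fun t => φ t * t ^ (β - 1)) (volume.restrict (Set.Ioi 0)) :=
    hm.mul (by fun_prop : Measurable fun t : ℝ => t ^ (β - 1)).aestronglyMeasurable
  have hU : Set.Ioi (0 : ℝ) = Set.Ioc 0 T ∪ Set.Ioi T := (Set.Ioc_union_Ioi_eq_Ioi hT.le).symm
  have i1 : IntegrableOn (fun t : ℝ => h * t ^ (β - 1)) (Set.Ioc 0 T) :=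
    (integrableOn_Ioc_rpow_sub_one hβ hT).const_mul h
  have i2 : IntegrableOn (fun t : ℝ => A * t ^ (β - σ - 1)) (Set.Ioi T) :=
    (integrableOn_Ioi_rpow_of_lt (by linarith) hT).const_mul A
  have b1 : ∀ t ∈ Set.Ioc 0 T, φ t * t ^ (β - 1) ≤ h * t ^ (β - 1) := fun t ht =>
    mul_le_mul_of_nonneg_right (h1 t ht.1) (rpow_nonneg ht.1.le _)
  have b2 : ∀ t ∈ Set.Ioi T, φ t * t ^ (β - 1) ≤ A * t ^ (β - σ - 1) := fun t ht => by
    have ht0 : 0 < t := hT.trans ht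
    refine (mul_le_mul_of_nonneg_right (h2 t ht0) (rpow_nonneg ht0.le _)).trans_eq ?_
    rw [mul_assoc, ← rpow_add ht0]
    congr 2
    ring
  have j1 : IntegrableOn (fun t => φ t * t ^ (β - 1)) (Set.Ioc 0 T) := by
    refine Integrable.mono' i1 (hmeas.mono_set Set.Ioc_subset_Ioi_self) ?_
    filter_upwards [ae_restrict_mem measurableSet_Ioc] with t ht
    rw [norm_of_nonneg (mul_nonneg (h0 t ht.1) (rpow_nonneg ht.1.le _))]
    exact b1 t ht
  have j2 : IntegrableOn (fun t => φ t * t ^ (β - 1)) (Set.Ioi T) := by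
    refine Integrable.mono' i2 (hmeas.mono_set (Set.Ioi_subset_Ioi hT.le)) ?_
    filter_upwards [ae_restrict_mem measurableSet_Ioi] with t ht
    have ht0 : 0 < t := hT.trans ht
    rw [norm_of_nonneg (mul_nonneg (h0 t ht0) (rpow_nonneg ht0.le _))]
    exact b2 t ht
  refine ⟨hU ▸ j1.union j2, ?_⟩
  rw [hU, setIntegral_union (Set.Ioc_disjoint_Ioi le_rfl) measurableSet_Ioi j1 j2]
  refine add_le_add ((setIntegral_mono_on j1 i1 measurableSet_Ioc b1).trans_eq ?_)
    ((setIntegral_mono_on j2 i2 measurableSet_Ioi b2).trans_eq ?_)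
  · rw [integral_const_mul, integral_Ioc_rpow_sub_one hβ hT]
  · rw [integral_const_mul, integral_Ioi_rpow_of_lt (by linarith) hT, sub_add_cancel,
      ← neg_div_neg_eq, neg_neg, neg_sub]

variable {α : ℝ}

theorem integrableOn_heatKernel_mul_rpow (hα : 0 < α) (hαN : α < N) (x y : LatticePoint N) :
    IntegrableOn (fun t => heatKernel t x y * t ^ (α / 2 - 1)) (Set.Ioi 0) :=
  (integrableOn_mul_rpow_and_integral_le (σ := N / 2) (h := 1) (A := 1) (T := 1) (by linarith)
    (by linarith) one_pos (aestronglyMeasurable_heatKernel x y)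
    (fun _ ht => heatKernel_nonneg ht.le x y) (fun _ ht => heatKernel_le_one ht.le x y)
    (fun _ ht => by rw [one_mul]; exact heatKernel_le_rpow ht x y)).1

theorem green_symm (α : ℝ) (x y : LatticePoint N) : green α x y = green α y x := by
  unfold green
  simp only [heatKernel_symm _ x y]

theorem green_nonneg (hα : 0 < α) (x y : LatticePoint N) : 0 ≤ green α x y :=
  mul_nonneg (inv_nonneg.2 (Gamma_pos_of_pos (by linarith)).le)
    (setIntegral_nonneg measurableSet_Ioi fun t (ht : 0 < t) =>
      mul_nonneg (heatKernel_nonneg ht.le x y) (rpow_nonneg ht.le _))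

theorem green_self_pos (hα : 0 < α) (hαN : α < N) (x : LatticePoint N) : 0 < green α x x := by
  refine mul_pos (inv_pos.2 (Gamma_pos_of_pos (by linarith))) ?_
  have hpos : ∀ t ∈ Set.Ioi (0 : ℝ), 0 < heatKernel t x x * t ^ (α / 2 - 1) :=
    fun t (ht : 0 < t) => mul_pos (heatKernel_self_pos ht.le x) (rpow_pos_of_pos ht _)
  rw [setIntegral_pos_iff_support_of_nonneg_ae
    ((ae_restrict_mem measurableSet_Ioi).mono fun t ht => (hpos t ht).le)
    (integrableOn_heatKernel_mul_rpow hα hαN x x)]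
  have hsub : Set.Ioi (0 : ℝ) ⊆ Function.support fun t => heatKernel t x x * t ^ (α / 2 - 1) :=
    fun t ht => (hpos t ht).ne'
  rw [Set.inter_eq_right.2 hsub]
  simp

/-- Hölder's inequality with the weights `k_t(x, ·)`, whose total mass is at most 1, leaves `(∑ k_t
f^r)^{1/r}`, and the on-diagonal decay applies to it. -/
theorem sum_heatKernel_mul_le {t r : ℝ} (ht : 0 < t) (hr : 1 ≤ r) {f : LatticePoint N → ℝ}
    (hf : ∀ y, 0 ≤ f y) (S : Finset (LatticePoint N)) (hS : ∑ y ∈ S, f y ^ r ≤ 1)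
    (x : LatticePoint N) : ∑ y ∈ S, heatKernel t x y * f y ≤ t ^ (-(N / (2 * r)) : ℝ) := by
  have hr0 : 0 < r := by linarith
  have k0 := fun y => heatKernel_nonneg ht.le x y
  refine (inner_le_weight_mul_Lp_of_nonneg S hr (heatKernel t x) f k0 hf).trans ?_
  have h1 : (∑ y ∈ S, heatKernel t x y) ^ (1 - r⁻¹) ≤ 1 :=
    rpow_le_one (Finset.sum_nonneg fun y _ => k0 y) (sum_heatKernel_le_one ht.le x S)
      (sub_nonneg.2 (inv_le_one_of_one_le₀ hr))
  have h2 : ∑ y ∈ S, heatKernel t x y * f y ^ r ≤ t ^ (-(N / 2) : ℝ) := by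
    calc ∑ y ∈ S, heatKernel t x y * f y ^ r ≤ ∑ y ∈ S, t ^ (-(N / 2) : ℝ) * f y ^ r :=
          Finset.sum_le_sum fun y _ => mul_le_mul_of_nonneg_right (heatKernel_le_rpow ht x y)
            (rpow_nonneg (hf y) _)
      _ ≤ t ^ (-(N / 2) : ℝ) := by
          rw [← Finset.mul_sum]
          exact mul_le_of_le_one_right (rpow_nonneg ht.le _) hS
  have h0 : 0 ≤ ∑ y ∈ S, heatKernel t x y * f y ^ r :=
    Finset.sum_nonneg fun y _ => mul_nonneg (k0 y) (rpow_nonneg (hf y) _)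
  calc _ ≤ 1 * (t ^ (-(N / 2) : ℝ)) ^ r⁻¹ :=
        mul_le_mul h1 (rpow_le_rpow h0 h2 (by positivity)) (rpow_nonneg h0 _) zero_le_one
    _ = _ := by
        rw [one_mul, ← rpow_mul ht.le]
        congr 1
        field_simp

/-- The critical exponent `2N/(N+α)` of the Hardy–Littlewood–Sobolev inequality. -/
def hlsExponent (N : ℕ) (α : ℝ) : ℝ := 2 * N / (N + α)

theorem one_lt_hlsExponent (hα : 0 < α) (hαN : α < N) : 1 < hlsExponent N α := by
  rw [hlsExponent, one_lt_div (by linarith)]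
  linarith

/-- The potential of the part of `f` below the level `h`. -/
theorem exists_sum_green_mul_le (hα : 0 < α) (hαN : α < N) :
    ∃ C : ℝ, 0 < C ∧ ∀ (f : LatticePoint N → ℝ) (S : Finset (LatticePoint N)) (h : ℝ),
      (∀ y, 0 ≤ f y) → ∑ y ∈ S, f y ^ hlsExponent N α ≤ 1 → 0 < h → (∀ y ∈ S, f y ≤ h) →
        ∀ x, ∑ y ∈ S, green α x y * f y ≤ C * h ^ (hlsExponent N α - 1) := by
  set r := hlsExponent N α with hr
  -- This is `N/(2r)`, the decay rate of `e^{tΔ} f` for `f` in the unit ball of `ℓ^r`; it exceeds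
  -- `α/2` because `α < N`.
  set σ : ℝ := (N + α) / 4 with hσ
  have hN : 0 < (N : ℝ) := hα.trans hαN
  have hσr : (N : ℝ) / (2 * r) = σ := by
    rw [hr, hσ, hlsExponent]
    field_simp
    norm_num
  have hσ0 : 0 < σ := by rw [hσ]; linarith
  have hβσ : α / 2 < σ := by rw [hσ]; linarith
  have hΓ : 0 < Gamma (α / 2) := Gamma_pos_of_pos (by linarith)
  have hc : 0 < 1 / (α / 2) + 1 / (σ - α / 2) :=
    add_pos (by positivity) (one_div_pos.2 (by linarith))
  refine ⟨(Gamma (α / 2))⁻¹ * (1 / (α / 2) + 1 / (σ - α / 2)), mul_pos (inv_pos.2 hΓ) hc,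
    fun f S h hf hS hh hfh x => ?_⟩
  have hint := fun y => integrableOn_heatKernel_mul_rpow hα hαN x y
  have e : ∑ y ∈ S, green α x y * f y = (Gamma (α / 2))⁻¹ *
      ∫ t in Set.Ioi (0 : ℝ), (∑ y ∈ S, heatKernel t x y * f y) * t ^ (α / 2 - 1) := by
    have : ∀ t : ℝ, (∑ y ∈ S, heatKernel t x y * f y) * t ^ (α / 2 - 1) =
        ∑ y ∈ S, heatKernel t x y * t ^ (α / 2 - 1) * f y := fun t => by
      rw [Finset.sum_mul]
      exact Finset.sum_congr rfl fun y _ => by ring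
    simp only [this]
    rw [integral_finsetSum _ fun y _ => (hint y).mul_const _, Finset.mul_sum]
    refine Finset.sum_congr rfl fun y _ => ?_
    rw [integral_mul_const, green, mul_assoc]
  rw [e, mul_assoc]
  refine mul_le_mul_of_nonneg_left ?_ (inv_nonneg.2 hΓ.le)
  -- The time at which the bounds `h` and `t^{-σ}` for the heat flow coincide. Both parts of the
  -- integral are then multiples of `h T^{α/2} = h^{r-1}`.
  set T : ℝ := h ^ (-(1 / σ)) with hT
  have hT0 : 0 < T := rpow_pos_of_pos hh _
  refine (integrableOn_mul_rpow_and_integral_le (h := h) (A := 1) (T := T) (by linarith : 0 < α / 2)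
    hβσ hT0 ?_ ?_ ?_ ?_).2.trans_eq ?_
  · have hmeas := Finset.aestronglyMeasurable_sum S fun y _ =>
      (aestronglyMeasurable_heatKernel x y).mul_const (f y)
    refine hmeas.congr (Filter.Eventually.of_forall fun t => ?_)
    simp
  · exact fun t ht => Finset.sum_nonneg fun y _ => mul_nonneg (heatKernel_nonneg ht.le x y) (hf y)
  · intro t ht
    calc _ ≤ ∑ y ∈ S, heatKernel t x y * h := Finset.sum_le_sum fun y hy =>
          mul_le_mul_of_nonneg_left (hfh y hy) (heatKernel_nonneg ht.le x y)
      _ ≤ h := by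
          rw [← Finset.sum_mul]
          exact mul_le_of_le_one_left hh.le (sum_heatKernel_le_one ht.le x S)
  · intro t ht
    rw [one_mul, ← hσr]
    exact sum_heatKernel_mul_le ht (one_lt_hlsExponent hα hαN).le hf S hS x
  · have h1 : T ^ (α / 2 - σ) = h * T ^ (α / 2) := by
      rw [sub_eq_add_neg, rpow_add hT0, mul_comm]
      congr 1
      rw [hT, ← rpow_mul hh.le]
      have : -(1 / σ) * -σ = 1 := by field_simp
      rw [this, rpow_one]
    have h2 : h ^ (r - 1) = h * T ^ (α / 2) := by
      rw [hT, ← rpow_mul hh.le]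
      nth_rewrite 2 [← rpow_one h]
      rw [← rpow_add hh]
      congr 1
      rw [hr, hσ, hlsExponent]
      field_simp
      ring
    rw [h1, h2]
    ring

/-- **Hardy–Littlewood–Sobolev inequality** on the lattice, on the diagonal and for finite sums. -/
theorem exists_hls (hα : 0 < α) (hαN : α < N) :
    ∃ C : ℝ, 0 < C ∧ ∀ (f : LatticePoint N → ℝ) (S : Finset (LatticePoint N)), (∀ y, 0 ≤ f y) →
      ∑ x ∈ S, ∑ y ∈ S, green α x y * f x * f y ≤
        C * (∑ y ∈ S, f y ^ hlsExponent N α) ^ (2 / hlsExponent N α) := by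
  obtain ⟨C, hC, key⟩ := exists_sum_green_mul_le hα hαN
  set r := hlsExponent N α with hr
  have hr1 : 1 < r := one_lt_hlsExponent hα hαN
  have hr0 : 0 < r := by linarith
  have normalized : ∀ (f : LatticePoint N → ℝ) (S : Finset (LatticePoint N)), (∀ y, 0 ≤ f y) →
      ∑ y ∈ S, f y ^ r ≤ 1 → ∑ x ∈ S, ∑ y ∈ S, green α x y * f x * f y ≤ 2 * C := by
    intro f S hf hS
    have hg := fun x y => green_nonneg (N := N) hα x y
    -- Each pair is charged to the point with the larger value. For fixed `x` only values at most `f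
    -- x` remain, and the level estimate with `h = f x` yields `f x * C (f x)^{r-1} = C (f x)^r`; no
    -- interpolation is needed.
    let g : LatticePoint N → LatticePoint N → ℝ := fun x y =>
      if f y ≤ f x then green α x y * f x * f y else 0
    have h1 : ∀ x y, green α x y * f x * f y ≤ g x y + g y x := by
      intro x y
      have hn : 0 ≤ green α x y * f x * f y := mul_nonneg (mul_nonneg (hg x y) (hf x)) (hf y)
      have hs : green α y x * f y * f x = green α x y * f x * f y := by rw [green_symm]; ring
      simp only [g, hs]
      split_ifs <;> linarith
    have h2 : ∀ x, ∑ y ∈ S, g x y ≤ C * f x ^ r := by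
      intro x
      rcases (hf x).eq_or_lt with hx | hx
      · rw [← hx, zero_rpow hr0.ne', mul_zero]
        exact Finset.sum_nonpos fun y _ => by simp [g, ← hx]
      · simp only [g]
        rw [← Finset.sum_filter]
        have := key f (S.filter fun y => f y ≤ f x) (f x) hf
          ((Finset.sum_le_sum_of_subset_of_nonneg (Finset.filter_subset _ _)
            fun y _ _ => rpow_nonneg (hf y) _).trans hS) hx
          (fun y hy => (Finset.mem_filter.1 hy).2) x
        calc _ = f x * ∑ y ∈ S.filter (fun y => f y ≤ f x), green α x y * f y := by
              rw [Finset.mul_sum]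
              exact Finset.sum_congr rfl fun y _ => by ring
          _ ≤ f x * (C * f x ^ (r - 1)) := mul_le_mul_of_nonneg_left this hx.le
          _ = C * f x ^ r := by
              rw [rpow_sub_one hx.ne']
              field_simp
    calc _ ≤ ∑ x ∈ S, ∑ y ∈ S, (g x y + g y x) :=
          Finset.sum_le_sum fun x _ => Finset.sum_le_sum fun y _ => h1 x y
      _ = 2 * ∑ x ∈ S, ∑ y ∈ S, g x y := by
          simp only [Finset.sum_add_distrib]
          rw [Finset.sum_comm (f := fun x y => g y x)]
          ring
      _ ≤ 2 * ∑ x ∈ S, C * f x ^ r := by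
          gcongr with x _
          exact h2 x
      _ ≤ 2 * C := by
          rw [← Finset.mul_sum]
          exact mul_le_mul_of_nonneg_left (mul_le_of_le_one_right hC.le hS) zero_le_two
  refine ⟨2 * C, by positivity, fun f S hf => ?_⟩
  have hA0 : 0 ≤ ∑ y ∈ S, f y ^ r := Finset.sum_nonneg fun y _ => rpow_nonneg (hf y) _
  rcases hA0.eq_or_lt with hA | hA
  · have hz : ∀ y ∈ S, f y = 0 := fun y hy => by
      have := (Finset.sum_eq_zero_iff_of_nonneg fun y _ => rpow_nonneg (hf y) _).1 hA.symm y hy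
      exact (rpow_eq_zero (hf y) hr0.ne').1 this
    rw [Finset.sum_eq_zero fun x hx => Finset.sum_eq_zero fun y _ => by simp [hz x hx]]
    positivity
  · set A := ∑ y ∈ S, f y ^ r with hAdef
    set m := A ^ (1 / r) with hm
    have hm0 : 0 < m := rpow_pos_of_pos hA _
    have hmr : m ^ r = A := by rw [hm, ← rpow_mul hA.le, one_div_mul_cancel hr0.ne', rpow_one]
    have h1 := normalized (fun y => f y / m) S (fun y => div_nonneg (hf y) hm0.le) (by
      simp only [div_rpow (hf _) hm0.le, hmr]
      rw [← Finset.sum_div, ← hAdef, div_self hA.ne'])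
    have h2 : A ^ (2 / r) = m ^ 2 := by
      rw [hm, ← rpow_natCast, ← rpow_mul hA.le]
      congr 1
      push_cast
      ring
    have h3 : ∑ x ∈ S, ∑ y ∈ S, green α x y * (f x / m) * (f y / m) =
        (∑ x ∈ S, ∑ y ∈ S, green α x y * f x * f y) / m ^ 2 := by
      simp only [Finset.sum_div]
      exact Finset.sum_congr rfl fun x _ => Finset.sum_congr rfl fun y _ => by
        field_simp
    rw [h3, div_le_iff₀ (by positivity)] at h1
    rw [h2]
    exact h1

end Green

/-! ### Bilinear forms, superposition operators and functionals on `ℓ^r` -/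

section Lp

open Real Filter Topology

variable {ι : Type*} {V W : Type*} [NormedAddCommGroup V] [NormedAddCommGroup W]

/-- The space `ℓ^r(ι; V)` for a real exponent. -/
abbrev Ell (ι V : Type*) [NormedAddCommGroup V] (r : ℝ) : Type _ :=
  lp (fun _ : ι => V) (ENNReal.ofReal r)

theorem Ell.norm_rpow {r : ℝ} (hr : 0 < r) (f : Ell ι V r) : ‖f‖ ^ r = ∑' i, ‖f i‖ ^ r := by
  have := lp.norm_rpow_eq_tsum (p := ENNReal.ofReal r)
    (by rwa [ENNReal.toReal_ofReal hr.le]) f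
  rwa [ENNReal.toReal_ofReal hr.le] at this

theorem Ell.summable {r : ℝ} (hr : 0 < r) (f : Ell ι V r) : Summable fun i => ‖f i‖ ^ r := by
  have := (lp.memℓp f).summable (by rwa [ENNReal.toReal_ofReal hr.le])
  rwa [ENNReal.toReal_ofReal hr.le] at this

theorem Ell.sum_le {r : ℝ} (hr : 0 < r) (f : Ell ι V r) (S : Finset ι) :
    ∑ i ∈ S, ‖f i‖ ^ r ≤ ‖f‖ ^ r := by
  rw [f.norm_rpow hr]
  exact (f.summable hr).sum_le_tsum S fun i _ => rpow_nonneg (norm_nonneg _) _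

theorem memEll {r : ℝ} (hr : 0 < r) {f : ι → V} (hf : Summable fun i => ‖f i‖ ^ r) :
    Memℓp f (ENNReal.ofReal r) := by
  refine memℓp_gen ?_
  rwa [ENNReal.toReal_ofReal hr.le]

theorem Ell.norm_le {r : ℝ} (hr : 0 < r) {f : Ell ι V r} {C : ℝ} (hC : 0 ≤ C)
    (h : ∑' i, ‖f i‖ ^ r ≤ C ^ r) : ‖f‖ ≤ C := by
  rwa [← f.norm_rpow hr, rpow_le_rpow_iff (lp.norm_nonneg' f) hC hr] at h

/-- For a nonnegative kernel a diagonal bound suffices: the terms for `f` and `g` are dominated by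
the quadratic ones for `|f| + |g|`. -/
theorem exists_kernelForm {r C : ℝ} (hr : 1 ≤ r) [Fact (1 ≤ ENNReal.ofReal r)] (hC : 0 ≤ C)
    {K : ι → ι → ℝ} (hK : ∀ i j, 0 ≤ K i j)
    (hb : ∀ (f : ι → ℝ) (S : Finset ι), (∀ i, 0 ≤ f i) →
      ∑ i ∈ S, ∑ j ∈ S, K i j * f i * f j ≤ C * (∑ i ∈ S, f i ^ r) ^ (2 / r)) :
    ∃ D : Ell ι ℝ r →L[ℝ] Ell ι ℝ r →L[ℝ] ℝ, ∀ f g,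
      HasSum (fun q : ι × ι => K q.1 q.2 * f q.1 * g q.2) (D f g) := by
  classical
  have hr0 : 0 < r := by linarith
  have hsum : ∀ (f g : Ell ι ℝ r) (Q : Finset (ι × ι)),
      ∑ q ∈ Q, ‖K q.1 q.2 * f q.1 * g q.2‖ ≤ C * (‖f‖ + ‖g‖) ^ 2 := by
    intro f g Q
    set S := Q.image Prod.fst ∪ Q.image Prod.snd with hS
    have hQ : Q ⊆ S ×ˢ S := fun q hq => Finset.mem_product.2
      ⟨Finset.mem_union_left _ (Finset.mem_image_of_mem _ hq),
        Finset.mem_union_right _ (Finset.mem_image_of_mem _ hq)⟩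
    have ha : ∀ i, 0 ≤ ‖f i‖ + ‖g i‖ := fun i => by positivity
    have hA : (∑ i ∈ S, (‖f i‖ + ‖g i‖) ^ r) ^ (1 / r) ≤ ‖f‖ + ‖g‖ := by
      refine (Lp_add_le_of_nonneg S hr (fun i _ => norm_nonneg (f i))
        fun i _ => norm_nonneg (g i)).trans (add_le_add ?_ ?_)
      · refine (rpow_le_rpow (Finset.sum_nonneg fun i _ => rpow_nonneg (norm_nonneg _) _)
          (f.sum_le hr0 S) (by positivity)).trans_eq ?_
        rw [← rpow_mul (norm_nonneg _), mul_one_div_cancel hr0.ne', rpow_one]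
      · refine (rpow_le_rpow (Finset.sum_nonneg fun i _ => rpow_nonneg (norm_nonneg _) _)
          (g.sum_le hr0 S) (by positivity)).trans_eq ?_
        rw [← rpow_mul (norm_nonneg _), mul_one_div_cancel hr0.ne', rpow_one]
    have hA0 : 0 ≤ ∑ i ∈ S, (‖f i‖ + ‖g i‖) ^ r :=
      Finset.sum_nonneg fun i _ => rpow_nonneg (ha i) _
    calc ∑ q ∈ Q, ‖K q.1 q.2 * f q.1 * g q.2‖
        ≤ ∑ q ∈ Q, K q.1 q.2 * (‖f q.1‖ + ‖g q.1‖) * (‖f q.2‖ + ‖g q.2‖) := by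
          refine Finset.sum_le_sum fun q _ => ?_
          rw [norm_mul, norm_mul, norm_of_nonneg (hK _ _)]
          have := hK q.1 q.2
          gcongr
          · linarith [norm_nonneg (g q.1)]
          · linarith [norm_nonneg (f q.2)]
      _ ≤ ∑ q ∈ S ×ˢ S, K q.1 q.2 * (‖f q.1‖ + ‖g q.1‖) * (‖f q.2‖ + ‖g q.2‖) :=
          Finset.sum_le_sum_of_subset_of_nonneg hQ fun q _ _ =>
            mul_nonneg (mul_nonneg (hK _ _) (ha _)) (ha _)
      _ = ∑ i ∈ S, ∑ j ∈ S, K i j * (‖f i‖ + ‖g i‖) * (‖f j‖ + ‖g j‖) := Finset.sum_product _ _ _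
      _ ≤ C * (∑ i ∈ S, (‖f i‖ + ‖g i‖) ^ r) ^ (2 / r) := hb _ S ha
      _ ≤ C * (‖f‖ + ‖g‖) ^ 2 := by
          refine mul_le_mul_of_nonneg_left ?_ hC
          have : 2 / r = 1 / r * (2 : ℕ) := by push_cast; ring
          rw [this, rpow_mul hA0, rpow_natCast]
          exact pow_le_pow_left₀ (rpow_nonneg hA0 _) hA 2
  have hsummable : ∀ f g : Ell ι ℝ r, Summable fun q : ι × ι => ‖K q.1 q.2 * f q.1 * g q.2‖ :=
    fun f g => summable_of_sum_le (fun q => norm_nonneg _) (hsum f g)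
  have hbound : ∀ f g : Ell ι ℝ r,
      ‖∑' q : ι × ι, K q.1 q.2 * f q.1 * g q.2‖ ≤ C * (‖f‖ + ‖g‖) ^ 2 := fun f g =>
    (norm_tsum_le_tsum_norm (hsummable f g)).trans
      ((hsummable f g).tsum_le_of_sum_le (hsum f g))
  let B : Ell ι ℝ r →ₗ[ℝ] Ell ι ℝ r →ₗ[ℝ] ℝ := LinearMap.mk₂ ℝ
    (fun f g => ∑' q : ι × ι, K q.1 q.2 * f q.1 * g q.2)
    (fun f f' g => by
      rw [← (hsummable f g).of_norm.tsum_add (hsummable f' g).of_norm]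
      exact tsum_congr fun q => by rw [lp.coeFn_add, Pi.add_apply]; ring)
    (fun c f g => by
      rw [smul_eq_mul, ← tsum_mul_left]
      exact tsum_congr fun q => by rw [lp.coeFn_smul, Pi.smul_apply, smul_eq_mul]; ring)
    (fun f g g' => by
      rw [← (hsummable f g).of_norm.tsum_add (hsummable f g').of_norm]
      exact tsum_congr fun q => by rw [lp.coeFn_add, Pi.add_apply]; ring)
    (fun c f g => by
      rw [smul_eq_mul, ← tsum_mul_left]
      exact tsum_congr fun q => by rw [lp.coeFn_smul, Pi.smul_apply, smul_eq_mul]; ring)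
  -- The bound `C(‖f‖ + ‖g‖)²` is applied to unit vectors, where it equals `4C`.
  have hBnorm : ∀ f g, ‖B f g‖ ≤ 4 * C * ‖f‖ * ‖g‖ := by
    intro f g
    rcases eq_or_ne f 0 with rfl | hf
    · simp
    rcases eq_or_ne g 0 with rfl | hg
    · simp
    have hf' := norm_pos_iff.2 hf
    have hg' := norm_pos_iff.2 hg
    have h1 : ‖B (‖f‖⁻¹ • f) (‖g‖⁻¹ • g)‖ ≤ C * (1 + 1) ^ 2 := by
      refine (hbound _ _).trans_eq ?_
      rw [norm_smul, norm_smul, norm_inv, norm_inv, norm_norm, norm_norm,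
        inv_mul_cancel₀ hf'.ne', inv_mul_cancel₀ hg'.ne']
    rw [map_smul, map_smul, LinearMap.smul_apply, norm_smul, norm_smul, norm_inv, norm_inv,
      norm_norm, norm_norm, ← mul_assoc, ← mul_inv, inv_mul_le_iff₀ (by positivity)] at h1
    linarith
  exact ⟨B.mkContinuous₂ (4 * C) hBnorm, fun f g => (hsummable f g).of_norm.hasSum⟩

/-- A bounded, pointwise null family in `ℓ^r`, `1 < r < ∞`, is weakly null. -/
theorem tendsto_functional_of_pointwise {r M : ℝ} (hr : 1 < r) [Fact (1 ≤ ENNReal.ofReal r)]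
    (φ : Ell ι ℝ r →L[ℝ] ℝ) {κ : Type*} {l : Filter κ} {g : κ → Ell ι ℝ r} (hM : ∀ n, ‖g n‖ ≤ M)
    (hg : ∀ i, Tendsto (fun n => g n i) l (𝓝 0)) : Tendsto (fun n => φ (g n)) l (𝓝 0) := by
  classical
  have hr0 : 0 < r := by linarith
  -- Here `r > 1` is essential: in `ℓ^1` the unit vectors are bounded and pointwise null but not
  -- weakly null.
  have hconj : r.HolderConjugate r.conjExponent := .conjExponent hr
  set s := r.conjExponent with hs
  have hs0 : 0 < s := hconj.symm.pos
  set h : ι → ℝ := fun i => φ (lp.single (ENNReal.ofReal r) i 1) with hh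
  have hsingle : ∀ i (c : ℝ), φ (lp.single (ENNReal.ofReal r) i c) = h i * c := by
    intro i c
    have : lp.single (E := fun _ : ι => ℝ) (ENNReal.ofReal r) i c =
        c • lp.single (E := fun _ : ι => ℝ) (ENNReal.ofReal r) i 1 := by
      rw [← lp.single_smul, smul_eq_mul, mul_one]
    rw [this, map_smul, smul_eq_mul, mul_comm]
  have hhs : Summable fun i => |h i| ^ s := by
    refine summable_of_sum_le (c := ‖φ‖ ^ s) (fun i => rpow_nonneg (abs_nonneg _) _) fun S => ?_
    set A := ∑ i ∈ S, |h i| ^ s with hA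
    have hA0 : 0 ≤ A := Finset.sum_nonneg fun i _ => rpow_nonneg (abs_nonneg _) _
    rcases hA0.eq_or_lt with h0 | hpos
    · rw [← h0]; positivity
    -- The extremal vector in Hölder's inequality; testing `φ` on it shows that its coefficients `h`
    -- lie in `ℓ^s`.
    let c : ι → ℝ := fun i => SignType.sign (h i) * |h i| ^ (s - 1)
    have hc : ∀ i, h i * c i = |h i| ^ s := by
      intro i
      by_cases h0 : h i = 0
      · simp [c, h0, zero_rpow hs0.ne']
      · simp only [c]
        rw [← mul_assoc, mul_comm (h i), sign_mul_self, rpow_sub_one (abs_ne_zero.2 h0)]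
        field_simp [abs_ne_zero.2 h0]
    have hc' : ∀ i, ‖c i‖ ^ r = |h i| ^ s := by
      intro i
      by_cases h0 : h i = 0
      · simp [c, h0, zero_rpow hs0.ne', zero_rpow hr0.ne']
      · have h1 : |((SignType.sign (h i) : SignType) : ℝ)| = 1 := by
          rcases lt_or_gt_of_ne h0 with h | h <;> simp [h]
        simp only [c, norm_mul, norm_eq_abs, h1, one_mul]
        rw [abs_of_nonneg (rpow_nonneg (abs_nonneg _) _), ← rpow_mul (abs_nonneg _)]
        congr 1
        have := hconj.symm.sub_one_mul_conj
        linarith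
    have e1 : φ (∑ i ∈ S, lp.single (E := fun _ : ι => ℝ) (ENNReal.ofReal r) i (c i)) = A := by
      rw [map_sum, hA]
      exact Finset.sum_congr rfl fun i _ => by rw [hsingle, hc]
    have e2 : ‖∑ i ∈ S, lp.single (E := fun _ : ι => ℝ) (ENNReal.ofReal r) i (c i)‖ ^ r = A := by
      have := lp.norm_sum_single (E := fun _ : ι => ℝ) (p := ENNReal.ofReal r)
        (by rwa [ENNReal.toReal_ofReal hr0.le]) c S
      rw [ENNReal.toReal_ofReal hr0.le] at this
      rw [this, hA]
      exact Finset.sum_congr rfl fun i _ => hc' i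
    set τ := ∑ i ∈ S, lp.single (E := fun _ : ι => ℝ) (ENNReal.ofReal r) i (c i) with hτ
    have h1 : A ≤ ‖φ‖ * ‖τ‖ := by
      rw [← e1]
      exact (le_abs_self _).trans (φ.le_opNorm τ)
    have hτ0 : 0 < ‖τ‖ := by
      refine (norm_nonneg _).lt_of_ne fun h0 => ?_
      rw [← h0, zero_rpow hr0.ne'] at e2
      exact hpos.ne e2
    have h2 : ‖τ‖ ^ (r - 1) ≤ ‖φ‖ := by
      rw [rpow_sub_one hτ0.ne', e2, div_le_iff₀ hτ0]
      exact h1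
    calc A = (‖τ‖ ^ (r - 1)) ^ s := by
          rw [← rpow_mul (norm_nonneg _), hconj.sub_one_mul_conj, e2]
      _ ≤ ‖φ‖ ^ s := rpow_le_rpow (rpow_nonneg (norm_nonneg _) _) h2 hs0.le
  have hφ : ∀ f : Ell ι ℝ r, HasSum (fun i => h i * f i) (φ f) := by
    intro f
    have := (lp.hasSum_single (p := ENNReal.ofReal r) ENNReal.ofReal_ne_top f).mapL φ
    simpa only [hsingle] using this
  have hM0 : 0 ≤ |M| := abs_nonneg M
  rw [Metric.tendsto_nhds]
  intro ε hε
  -- Outside `S` the coefficients have small `ℓ^s` norm, which controls the tail uniformly in `n`;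
  -- on `S` pointwise convergence is enough.
  obtain ⟨S, hS⟩ : ∃ S : Finset ι,
      (∑' i : { i // i ∉ S }, |h i| ^ s) ^ (1 / s) * |M| < ε / 2 := by
    have h1 := tendsto_tsum_compl_atTop_zero fun i => |h i| ^ s
    have h2 := (h1.rpow_const (p := 1 / s) (Or.inr (by positivity))).mul_const |M|
    rw [zero_rpow (by positivity), zero_mul] at h2
    exact (h2.eventually (gt_mem_nhds (half_pos hε))).exists
  have hfin : Tendsto (fun n => ∑ i ∈ S, h i * g n i) l (𝓝 0) := by
    have := tendsto_finsetSum S fun i _ => (hg i).const_mul (h i)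
    simpa using this
  filter_upwards [Metric.tendsto_nhds.1 hfin (ε / 2) (half_pos hε)] with n hn
  rw [dist_zero_right] at hn ⊢
  have hsplit := (hφ (g n)).summable.sum_add_tsum_subtype_compl S
  rw [(hφ (g n)).tsum_eq] at hsplit
  have ginj : Summable fun i : { i // i ∉ S } => |g n i| ^ r :=
    ((g n).summable hr0).comp_injective Subtype.val_injective
  have hinj : Summable fun i : { i // i ∉ S } => |h i| ^ s :=
    hhs.comp_injective Subtype.val_injective
  have hprod := summable_mul_of_Lp_Lq_of_nonneg hconj.symm
    (fun i : { i // i ∉ S } => abs_nonneg (h i)) (fun i => abs_nonneg (g n i)) hinj ginj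
  have htail : |∑' i : { i // i ∉ S }, h i * g n i| ≤
      (∑' i : { i // i ∉ S }, |h i| ^ s) ^ (1 / s) * |M| := by
    have h3 : Summable fun i : { i // i ∉ S } => ‖h i * g n i‖ := by
      simpa only [norm_mul, norm_eq_abs] using hprod
    refine (norm_tsum_le_tsum_norm h3).trans ?_
    simp only [norm_mul, norm_eq_abs]
    refine (inner_le_Lp_mul_Lq_tsum_of_nonneg hconj.symm
      (fun i : { i // i ∉ S } => abs_nonneg (h i)) (fun i => abs_nonneg (g n i)) hinj ginj).trans ?_
    refine mul_le_mul_of_nonneg_left ?_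
      (rpow_nonneg (tsum_nonneg fun i => rpow_nonneg (abs_nonneg _) _) _)
    have h4 : ∑' i : { i // i ∉ S }, |g n i| ^ r ≤ |M| ^ r := by
      calc _ ≤ ∑' i, |g n i| ^ r := ((g n).summable hr0).tsum_subtype_le _ _
              fun i => rpow_nonneg (abs_nonneg _) _
        _ = ‖g n‖ ^ r := ((g n).norm_rpow hr0).symm
        _ ≤ |M| ^ r := rpow_le_rpow (norm_nonneg _) ((hM n).trans (le_abs_self M)) hr0.le
    refine (rpow_le_rpow (tsum_nonneg fun i => rpow_nonneg (abs_nonneg _) _) h4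
      (by positivity)).trans_eq ?_
    rw [← rpow_mul hM0, mul_one_div_cancel hr0.ne', rpow_one]
  rw [← hsplit]
  exact (norm_add_le _ _).trans_lt (by rw [norm_eq_abs (∑' _, _)]; linarith)

end Lp

/-! ### Homogeneous functions and their superposition operators -/

section Homogeneous

open Real Filter Topology

variable {ι : Type*} {V W : Type*} [NormedAddCommGroup V] [NormedSpace ℝ V]
  [NormedAddCommGroup W] [NormedSpace ℝ W]

theorem map_zero_of_homogeneous {H : V → W} {β : ℝ} (hβ : 0 < β)
    (hH : ∀ t : ℝ, 0 < t → ∀ v, H (t • v) = t ^ β • H v) : H 0 = 0 := by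
  have h := hH 2 two_pos 0
  rw [smul_zero, ← sub_eq_zero, ← neg_eq_zero, neg_sub] at h
  have h2 : ((2 : ℝ) ^ β - 1) • H 0 = 0 := by rw [sub_smul, one_smul, h]
  refine (smul_eq_zero.1 h2).resolve_left ?_
  have := one_lt_rpow (x := 2) one_lt_two hβ
  linarith

theorem fderiv_homogeneous {G : V → ℝ} {γ : ℝ} (hG : Differentiable ℝ G)
    (hH : ∀ t : ℝ, 0 < t → ∀ v, G (t • v) = t ^ γ • G v) {t : ℝ} (ht : 0 < t) (v : V) :
    fderiv ℝ G (t • v) = t ^ (γ - 1) • fderiv ℝ G v := by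
  have h1 : fderiv ℝ (fun w => G (t • w)) v = t • fderiv ℝ G (t • v) := by
    rw [fderiv_comp_smul]
  have h2 : fderiv ℝ (fun w => G (t • w)) v = t ^ γ • fderiv ℝ G v := by
    rw [show (fun w => G (t • w)) = fun w => t ^ γ • G w from funext (hH t ht),
      fderiv_fun_const_smul (hG v)]
  rw [h1] at h2
  rw [rpow_sub_one ht.ne', div_eq_inv_mul, mul_smul, ← h2, smul_smul, inv_mul_cancel₀ ht.ne',
    one_smul]

variable [FiniteDimensional ℝ V]

/-- Compactness of the unit sphere, extended by homogeneity. -/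
theorem exists_homogeneous_bound {H : V → W} {β : ℝ} (hβ : 0 < β) (hc : Continuous H)
    (hH : ∀ t : ℝ, 0 < t → ∀ v, H (t • v) = t ^ β • H v) :
    ∃ C, 0 < C ∧ ∀ v, ‖H v‖ ≤ C * ‖v‖ ^ β := by
  have : ProperSpace V := FiniteDimensional.proper_real V
  obtain ⟨C, hC⟩ := (isCompact_sphere (0 : V) 1).exists_bound_of_continuousOn hc.continuousOn
  refine ⟨max C 1, by positivity, fun v => ?_⟩
  rcases eq_or_ne v 0 with rfl | hv
  · rw [map_zero_of_homogeneous hβ hH, norm_zero]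
    positivity
  · have hv' := norm_pos_iff.2 hv
    have h1 : H v = ‖v‖ ^ β • H (‖v‖⁻¹ • v) := by
      rw [← hH _ hv', smul_smul, mul_inv_cancel₀ hv'.ne', one_smul]
    rw [h1, norm_smul, norm_of_nonneg (by positivity), mul_comm]
    refine mul_le_mul_of_nonneg_right ((hC _ ?_).trans (le_max_left _ _)) (by positivity)
    rw [mem_sphere_zero_iff_norm, norm_smul, norm_inv, norm_norm, inv_mul_cancel₀ hv'.ne']

/-- Uniform first order Taylor expansion of a homogeneous function. -/
theorem exists_homogeneous_taylor {G : V → ℝ} {γ : ℝ} (hγ : 1 < γ) (hG : ContDiff ℝ 1 G)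
    (hH : ∀ t : ℝ, 0 < t → ∀ v, G (t • v) = t ^ γ • G v) {ε : ℝ} (hε : 0 < ε) :
    ∃ C, 0 < C ∧ ∀ v w, |G (v + w) - G v - fderiv ℝ G v w| ≤
      ε * (‖v‖ ^ (γ - 1) * ‖w‖) + C * ‖w‖ ^ γ := by
  have : ProperSpace V := FiniteDimensional.proper_real V
  have hd : Differentiable ℝ G := hG.differentiable one_ne_zero
  have hc : Continuous (fderiv ℝ G) := hG.continuous_fderiv one_ne_zero
  have hγ1 : 0 < γ - 1 := by linarith
  have hdH : ∀ t : ℝ, 0 < t → ∀ v, fderiv ℝ G (t • v) = t ^ (γ - 1) • fderiv ℝ G v :=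
    fun t ht v => fderiv_homogeneous hd hH ht v
  obtain ⟨A, hA, hGA⟩ := exists_homogeneous_bound (by linarith : 0 < γ) hG.continuous hH
  obtain ⟨A', hA', hGA'⟩ := exists_homogeneous_bound hγ1 hc hdH
  have huc := (isCompact_closedBall (0 : V) 2).uniformContinuousOn_of_continuous hc.continuousOn
  obtain ⟨δ', hδ', huc⟩ := Metric.uniformContinuousOn_iff.1 huc ε hε
  set δ := min (δ' / 2) 1 with hδdef
  have hδ : 0 < δ := lt_min (half_pos hδ') one_pos
  -- Mean value inequality on a ball around `v`, where the derivative varies by at most `ε`; `δ ≤ 1`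
  -- keeps the ball inside the ball of radius 2 on which uniform continuity is known.
  have hunit : ∀ v w : V, ‖v‖ = 1 → ‖w‖ ≤ δ →
      |G (v + w) - G v - fderiv ℝ G v w| ≤ ε * ‖w‖ := by
    intro v w hv hw
    have := (convex_closedBall v δ).norm_image_sub_le_of_norm_fderiv_le' (𝕜 := ℝ) (f := G)
      (C := ε) (x := v) (y := v + w) (φ := fderiv ℝ G v) (fun x _ => hd x) (fun x hx => ?_)
      (Metric.mem_closedBall_self hδ.le) (by simpa using hw)
    · rwa [add_sub_cancel_left, norm_eq_abs] at this
    · rw [← dist_eq_norm]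
      have hxv := Metric.mem_closedBall.1 hx
      refine (huc x ?_ v ?_ ?_).le
      · rw [mem_closedBall_zero_iff]
        have h1 : ‖x‖ ≤ ‖v‖ + dist x v := by
          rw [dist_eq_norm, add_comm]
          exact norm_le_norm_sub_add x v
        have h2 : δ ≤ 1 := min_le_right _ _
        linarith
      · rw [mem_closedBall_zero_iff, hv]; norm_num
      · have h2 : δ ≤ δ' / 2 := min_le_left _ _
        linarith
  refine ⟨A * (δ⁻¹ + 1) ^ γ + A * δ⁻¹ ^ γ + A' * δ⁻¹ ^ (γ - 1), by positivity, fun v w => ?_⟩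
  -- A relatively small increment reduces to `‖v‖ = 1` by scaling. For a large one no cancellation
  -- is needed: each of the three terms is `O(‖w‖^γ)`.
  rcases le_or_gt ‖w‖ (δ * ‖v‖) with hw | hw
  · rcases eq_or_ne v 0 with rfl | hv
    · have hw0 : w = 0 := by simpa using hw
      subst hw0
      simp
      positivity
    have hv' := norm_pos_iff.2 hv
    set s := ‖v‖ with hs
    have ev : v = s • (s⁻¹ • v) := by rw [smul_smul, mul_inv_cancel₀ hv'.ne', one_smul]
    have ew : w = s • (s⁻¹ • w) := by rw [smul_smul, mul_inv_cancel₀ hv'.ne', one_smul]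
    have e1 : G (v + w) - G v - fderiv ℝ G v w = s ^ γ *
        (G (s⁻¹ • v + s⁻¹ • w) - G (s⁻¹ • v) - fderiv ℝ G (s⁻¹ • v) (s⁻¹ • w)) := by
      have hA : G (v + w) = s ^ γ * G (s⁻¹ • v + s⁻¹ • w) := by
        rw [← smul_eq_mul, ← hH s hv', smul_add, ← ev, ← ew]
      have hB : G v = s ^ γ * G (s⁻¹ • v) := by
        rw [← smul_eq_mul, ← hH s hv', ← ev]
      have hD : fderiv ℝ G v w = s ^ γ * fderiv ℝ G (s⁻¹ • v) (s⁻¹ • w) := by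
        conv_lhs => rw [ev, hdH s hv', _root_.smul_apply]
        rw [map_smul, smul_eq_mul, smul_eq_mul, rpow_sub_one hv'.ne']
        ring
      rw [hA, hB, hD]
      ring
    have h1 : ‖s⁻¹ • v‖ = 1 := by
      rw [norm_smul, norm_inv, norm_of_nonneg hv'.le, inv_mul_cancel₀ hv'.ne']
    have h2 : ‖s⁻¹ • w‖ = s⁻¹ * ‖w‖ := by rw [norm_smul, norm_inv, norm_of_nonneg hv'.le]
    have h3 : ‖s⁻¹ • w‖ ≤ δ := by
      rw [h2, inv_mul_le_iff₀ hv', mul_comm]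
      exact hw
    rw [e1, abs_mul, abs_of_nonneg (by positivity)]
    have h4 := mul_le_mul_of_nonneg_left (hunit _ _ h1 h3) (by positivity : 0 ≤ s ^ γ)
    refine h4.trans ?_
    rw [h2, rpow_sub_one hv'.ne']
    have e2 : s ^ γ * (ε * (s⁻¹ * ‖w‖)) = ε * (s ^ γ / s * ‖w‖) := by ring
    rw [e2]
    exact le_add_of_nonneg_right (by positivity)
  · have hwpos : 0 < ‖w‖ := lt_of_le_of_lt (by positivity) hw
    have hv : ‖v‖ ≤ δ⁻¹ * ‖w‖ := by
      rw [le_inv_mul_iff₀ hδ]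
      exact hw.le
    have hvw : ‖v + w‖ ≤ (δ⁻¹ + 1) * ‖w‖ := (norm_add_le _ _).trans (by linarith)
    have b1 : |G (v + w)| ≤ A * (δ⁻¹ + 1) ^ γ * ‖w‖ ^ γ := by
      refine (hGA _).trans ?_
      rw [mul_assoc, ← mul_rpow (by positivity) (by positivity)]
      gcongr
    have b2 : |G v| ≤ A * δ⁻¹ ^ γ * ‖w‖ ^ γ := by
      refine (hGA _).trans ?_
      rw [mul_assoc, ← mul_rpow (by positivity) (by positivity)]
      gcongr
    have b3 : |fderiv ℝ G v w| ≤ A' * δ⁻¹ ^ (γ - 1) * ‖w‖ ^ γ := by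
      refine ((fderiv ℝ G v).le_opNorm w).trans ?_
      have : ‖w‖ ^ γ = ‖w‖ ^ (γ - 1) * ‖w‖ := by rw [rpow_sub_one hwpos.ne']; field_simp
      rw [this, ← mul_assoc, mul_assoc A', ← mul_rpow (by positivity) (by positivity)]
      refine mul_le_mul_of_nonneg_right ((hGA' v).trans ?_) (norm_nonneg _)
      gcongr
    calc _ ≤ |G (v + w)| + |G v| + |fderiv ℝ G v w| := by
          refine (abs_sub _ _).trans ?_
          gcongr
          exact abs_sub _ _
      _ ≤ (A * (δ⁻¹ + 1) ^ γ + A * δ⁻¹ ^ γ + A' * δ⁻¹ ^ (γ - 1)) * ‖w‖ ^ γ := by linarith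
      _ ≤ _ := le_add_of_nonneg_left (by positivity)

end Homogeneous

/-! ### Differentiability of superposition operators from `ℓ^{γr}` to `ℓ^r` -/

section Superposition

open Real Filter Topology

variable {ι : Type*} {V : Type*} [NormedAddCommGroup V]

/-- Hölder's inequality in the form needed for superposition operators. -/
theorem Ell.rpow_mul_holder {γ r : ℝ} (hγ : 1 < γ) (hr : 0 < r) (f w : Ell ι V (γ * r)) :
    Summable (fun i => (‖f i‖ ^ (γ - 1) * ‖w i‖) ^ r) ∧
      ∑' i, (‖f i‖ ^ (γ - 1) * ‖w i‖) ^ r ≤ (‖f‖ ^ (γ - 1) * ‖w‖) ^ r := by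
  have hγ0 : 0 < γ := by linarith
  have hq : 0 < γ * r := by positivity
  have hconj : γ.HolderConjugate γ.conjExponent := .conjExponent hγ
  have e1 : ∀ i, (‖w i‖ ^ r) ^ γ = ‖w i‖ ^ (γ * r) := fun i => by
    rw [← rpow_mul (norm_nonneg _)]
    congr 1
    ring
  have hce : (γ - 1) * r * γ.conjExponent = γ * r := by
    rw [conjExponent]
    have : γ - 1 ≠ 0 := by linarith
    field_simp
  have e2 : ∀ i, (‖f i‖ ^ ((γ - 1) * r)) ^ γ.conjExponent = ‖f i‖ ^ (γ * r) := fun i => by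
    rw [← rpow_mul (norm_nonneg _), hce]
  have hw : Summable fun i => (‖w i‖ ^ r) ^ γ := by simpa only [e1] using w.summable hq
  have hf : Summable fun i => (‖f i‖ ^ ((γ - 1) * r)) ^ γ.conjExponent := by
    simpa only [e2] using f.summable hq
  have e3 : ∀ i, (‖f i‖ ^ (γ - 1) * ‖w i‖) ^ r = ‖w i‖ ^ r * ‖f i‖ ^ ((γ - 1) * r) := fun i => by
    rw [mul_rpow (by positivity) (norm_nonneg _), ← rpow_mul (norm_nonneg _), mul_comm]
  have nw : ∀ i, 0 ≤ ‖w i‖ ^ r := fun i => by positivity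
  have nf : ∀ i, 0 ≤ ‖f i‖ ^ ((γ - 1) * r) := fun i => by positivity
  simp only [e3]
  refine ⟨summable_mul_of_Lp_Lq_of_nonneg hconj nw nf hw hf, ?_⟩
  refine (inner_le_Lp_mul_Lq_tsum_of_nonneg hconj nw nf hw hf).trans_eq ?_
  simp only [e1, e2]
  have hwn := lp.norm_nonneg' w
  have hfn := lp.norm_nonneg' f
  rw [← w.norm_rpow hq, ← f.norm_rpow hq, ← rpow_mul hwn, ← rpow_mul hfn,
    mul_rpow (by positivity) hwn, ← rpow_mul hfn, mul_comm]
  congr 2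
  · rw [← hce]
    have := hconj.symm.ne_zero
    field_simp
  · field_simp

theorem rpow_sub_one_mul_self {γ x : ℝ} (hγ : 0 < γ) (hx : 0 ≤ x) : x ^ (γ - 1) * x = x ^ γ := by
  rcases hx.eq_or_lt with rfl | hx
  · rw [mul_zero, zero_rpow hγ.ne']
  · rw [rpow_sub_one hx.ne', div_mul_cancel₀ _ hx.ne']

/-- Serves both for the candidate derivative, of size `‖f‖^{γ-1}‖w‖`, and for the first term of the
Taylor remainder. -/
theorem Ell.holder_majorant {γ r C : ℝ} (hγ : 1 < γ) (hr : 0 < r) (hC : 0 ≤ C)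
    (f w : Ell ι V (γ * r)) {g : ι → ℝ} (hg : ∀ i, ‖g i‖ ≤ C * (‖f i‖ ^ (γ - 1) * ‖w i‖)) :
    ∃ h : Memℓp g (ENNReal.ofReal r), ‖(⟨g, h⟩ : Ell ι ℝ r)‖ ≤ C * (‖f‖ ^ (γ - 1) * ‖w‖) := by
  obtain ⟨h1, h2⟩ := f.rpow_mul_holder hγ hr w
  have le : ∀ i, ‖g i‖ ^ r ≤ C ^ r * (‖f i‖ ^ (γ - 1) * ‖w i‖) ^ r := fun i => by
    rw [← mul_rpow hC (by positivity)]
    exact rpow_le_rpow (norm_nonneg _) (hg i) hr.le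
  have hs : Summable fun i => ‖g i‖ ^ r :=
    Summable.of_nonneg_of_le (fun i => by positivity) le (h1.mul_left _)
  have hfw : 0 ≤ ‖f‖ ^ (γ - 1) * ‖w‖ :=
    mul_nonneg (rpow_nonneg (lp.norm_nonneg' f) _) (lp.norm_nonneg' w)
  refine ⟨memEll hr hs, Ell.norm_le hr (mul_nonneg hC hfw) ?_⟩
  rw [mul_rpow hC hfw]
  refine (hs.tsum_le_tsum le (h1.mul_left _)).trans ?_
  rw [tsum_mul_left]
  exact mul_le_mul_of_nonneg_left h2 (by positivity)

theorem Ell.power_majorant {γ r C : ℝ} (hγ : 1 < γ) (hr : 0 < r) (hC : 0 ≤ C)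
    (f : Ell ι V (γ * r)) {g : ι → ℝ} (hg : ∀ i, ‖g i‖ ≤ C * ‖f i‖ ^ γ) :
    ∃ h : Memℓp g (ENNReal.ofReal r), ‖(⟨g, h⟩ : Ell ι ℝ r)‖ ≤ C * ‖f‖ ^ γ := by
  have hγ0 : 0 < γ := by linarith
  rw [← rpow_sub_one_mul_self hγ0 (lp.norm_nonneg' f)]
  refine f.holder_majorant hγ hr hC f fun i => ?_
  rw [rpow_sub_one_mul_self hγ0 (norm_nonneg _)]
  exact hg i

variable [NormedSpace ℝ V] [FiniteDimensional ℝ V]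

/-- The superposition operator of a homogeneous `C^1` function is Fréchet differentiable. -/
theorem exists_superposition {γ r : ℝ} (hγ : 1 < γ) (hr : 1 ≤ r)
    [Fact (1 ≤ ENNReal.ofReal r)] [Fact (1 ≤ ENNReal.ofReal (γ * r))] {G : V → ℝ}
    (hG : ContDiff ℝ 1 G) (hH : ∀ t : ℝ, 0 < t → ∀ v, G (t • v) = t ^ γ • G v) :
    ∃ Φ : Ell ι V (γ * r) → Ell ι ℝ r, (∀ f i, Φ f i = G (f i)) ∧
      ∀ f, ∃ Φ' : Ell ι V (γ * r) →L[ℝ] Ell ι ℝ r, HasFDerivAt Φ Φ' f := by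
  have hr0 : 0 < r := by linarith
  have hd : Differentiable ℝ G := hG.differentiable one_ne_zero
  obtain ⟨A, hA, hGA⟩ := exists_homogeneous_bound (by linarith : 0 < γ) hG.continuous hH
  obtain ⟨A', hA', hGA'⟩ := exists_homogeneous_bound (by linarith : 0 < γ - 1)
    (hG.continuous_fderiv one_ne_zero) fun t ht v => fderiv_homogeneous hd hH ht v
  have hΦ : ∀ f : Ell ι V (γ * r), Memℓp (fun i => G (f i)) (ENNReal.ofReal r) :=
    fun f => (f.power_majorant hγ hr0 hA.le fun i => hGA _).1
  refine ⟨fun f => ⟨fun i => G (f i), hΦ f⟩, fun f i => rfl, fun f => ?_⟩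
  have hL : ∀ w : Ell ι V (γ * r), ∃ h : Memℓp (fun i => fderiv ℝ G (f i) (w i)) (ENNReal.ofReal r),
      ‖(⟨_, h⟩ : Ell ι ℝ r)‖ ≤ A' * (‖f‖ ^ (γ - 1) * ‖w‖) := fun w =>
    f.holder_majorant hγ hr0 hA'.le w fun i => ((fderiv ℝ G (f i)).le_opNorm (w i)).trans (by
      rw [← mul_assoc]
      exact mul_le_mul_of_nonneg_right (hGA' _) (norm_nonneg _))
  let L : Ell ι V (γ * r) →ₗ[ℝ] Ell ι ℝ r :=
    { toFun := fun w => ⟨fun i => fderiv ℝ G (f i) (w i), (hL w).1⟩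
      map_add' := fun w w' => lp.ext (funext fun i => map_add (fderiv ℝ G (f i)) (w i) (w' i))
      map_smul' := fun c w => lp.ext (funext fun i => map_smul (fderiv ℝ G (f i)) c (w i)) }
  refine ⟨L.mkContinuous (A' * ‖f‖ ^ (γ - 1)) fun w => (hL w).2.trans_eq (by ring), ?_⟩
  rw [hasFDerivAt_iff_isLittleO_nhds_zero, Asymptotics.isLittleO_iff]
  intro c hc
  have hF : 0 < ‖f‖ ^ (γ - 1) + 1 := by positivity
  -- This `ε` makes the first remainder term at most `(c/2)‖w‖`; the added 1 avoids division by zero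
  -- at `f = 0`. The second term `C‖w‖^γ` is `o(‖w‖)` because `γ > 1`.
  obtain ⟨C, hC, hTaylor⟩ := exists_homogeneous_taylor hγ hG hH
    (ε := c / 2 / (‖f‖ ^ (γ - 1) + 1)) (by positivity)
  have hsmall : ∀ᶠ w : Ell ι V (γ * r) in 𝓝 0, C * ‖w‖ ^ (γ - 1) < c / 2 := by
    have h1 : Continuous fun w : Ell ι V (γ * r) => C * ‖w‖ ^ (γ - 1) :=
      continuous_const.mul (continuous_norm.rpow_const fun _ => Or.inr (by linarith))
    refine h1.continuousAt.eventually (gt_mem_nhds ?_)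
    simp only
    rw [norm_zero, zero_rpow (by linarith), mul_zero]
    positivity
  filter_upwards [hsmall] with w hw
  obtain ⟨m1, b1⟩ := f.holder_majorant (C := c / 2 / (‖f‖ ^ (γ - 1) + 1)) hγ hr0 (by positivity) w
    (g := fun i => c / 2 / (‖f‖ ^ (γ - 1) + 1) * (‖f i‖ ^ (γ - 1) * ‖w i‖))
    fun i => (norm_of_nonneg (by positivity)).le
  obtain ⟨m2, b2⟩ := w.power_majorant (C := C) hγ hr0 hC.le (g := fun i => C * ‖w i‖ ^ γ)
    fun i => (norm_of_nonneg (by positivity)).le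
  have hmono := lp.norm_mono (p := ENNReal.ofReal r) (by simpa using hr0)
    (x := (⟨fun i => G ((f + w) i), hΦ (f + w)⟩ : Ell ι ℝ r) - ⟨fun i => G (f i), hΦ f⟩ - L w)
    (y := (⟨_, m1⟩ : Ell ι ℝ r) + ⟨_, m2⟩) fun i => by
      refine (hTaylor (f i) (w i)).trans ?_
      exact le_abs_self _
  refine hmono.trans ((norm_add_le _ _).trans ?_)
  have b3 : c / 2 / (‖f‖ ^ (γ - 1) + 1) * (‖f‖ ^ (γ - 1) * ‖w‖) ≤ c / 2 * ‖w‖ := by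
    rw [← mul_assoc]
    refine mul_le_mul_of_nonneg_right ?_ (norm_nonneg _)
    rw [div_mul_eq_mul_div, div_le_iff₀ hF]
    exact mul_le_mul_of_nonneg_left (by linarith) (by positivity)
  have b4 : C * ‖w‖ ^ γ ≤ c / 2 * ‖w‖ := by
    rw [← rpow_sub_one_mul_self (by linarith : 0 < γ) (norm_nonneg w), ← mul_assoc]
    exact mul_le_mul_of_nonneg_right hw.le (norm_nonneg _)
  linarith

end Superposition

/-! ### A variational principle for homogeneous functionals -/

section Abstract

open Real Filter Topology

variable {E : Type*} [NormedAddCommGroup E] [NormedSpace ℝ E]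

/-- A maximizer of a homogeneous functional `B` on the unit sphere yields, after scaling, a critical
point of `‖z‖^p / p - B z / (2γ)` of least energy on the Nehari set. -/
theorem exists_groundState_of_maximizer {p γ S : ℝ} (hp : 0 < p) (hpγ : p < 2 * γ) (hS : 0 < S)
    {B : E → ℝ} (hBhom : ∀ t : ℝ, 0 < t → ∀ z, B (t • z) = t ^ (2 * γ) * B z)
    (hBdiff : ∀ z, ∃ B' : E →L[ℝ] ℝ, HasFDerivAt B B' z)
    (hNdiff : ∀ z, ∃ N' : E →L[ℝ] ℝ, HasFDerivAt (fun z : E => ‖z‖ ^ p) N' z)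
    (hBS : ∀ z, B z ≤ S * ‖z‖ ^ (2 * γ)) {z₁ : E} (hz₁ : ‖z₁‖ = 1) (hBz₁ : B z₁ = S) :
    ∃ z : E, z ≠ 0 ∧
      HasFDerivAt (fun z : E => 1 / p * ‖z‖ ^ p - 1 / (2 * γ) * B z) (0 : E →L[ℝ] ℝ) z ∧
      IsGLB ((fun z : E => 1 / p * ‖z‖ ^ p - 1 / (2 * γ) * B z) '' {z | z ≠ 0 ∧
        ∃ J' : E →L[ℝ] ℝ, HasFDerivAt (fun z : E => 1 / p * ‖z‖ ^ p - 1 / (2 * γ) * B z) J' z ∧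
          J' z = 0}) (1 / p * ‖z‖ ^ p - 1 / (2 * γ) * B z) := by
  set J : E → ℝ := fun z => 1 / p * ‖z‖ ^ p - 1 / (2 * γ) * B z with hJ
  have hγ : 0 < 2 * γ := by linarith
  have hγ0 : γ ≠ 0 := by rintro rfl; simp at hγ
  have hd : 0 < 2 * γ - p := by linarith
  -- The solution of `S t^{2γ} = t^p`, which places `t z₁` on the Nehari set.
  set t : ℝ := S ^ (-(1 / (2 * γ - p))) with ht
  have ht0 : 0 < t := rpow_pos_of_pos hS _
  have htd : t ^ (2 * γ - p) = S⁻¹ := by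
    rw [ht, ← rpow_mul hS.le, neg_mul, one_div_mul_cancel hd.ne', rpow_neg_one]
  have hSt : S * t ^ (2 * γ) = t ^ p := by
    rw [show 2 * γ = (2 * γ - p) + p by ring, rpow_add ht0, htd, ← mul_assoc,
      mul_inv_cancel₀ hS.ne', one_mul]
  set z₀ := t • z₁ with hz₀
  have hnorm : ‖z₀‖ = t := by rw [hz₀, norm_smul, hz₁, mul_one, norm_of_nonneg ht0.le]
  have hBz₀ : B z₀ = t ^ p := by rw [hz₀, hBhom t ht0, hBz₁, mul_comm, hSt]
  have hne : z₀ ≠ 0 := by rw [← norm_pos_iff, hnorm]; exact ht0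
  have hcrit : HasFDerivAt J (0 : E →L[ℝ] ℝ) z₀ := by
    obtain ⟨N', hN'⟩ := hNdiff z₀
    obtain ⟨B', hB'⟩ := hBdiff z₀
    have hJ' : HasFDerivAt J ((1 / p) • N' - (1 / (2 * γ)) • B') z₀ :=
      (hN'.const_mul _).sub (hB'.const_mul _)
    -- A function of `‖z‖^p` alone, with `K ≤ J` everywhere and equality at `z₀`. Hence `J` and `K`
    -- have the same derivative at `z₀`, and that of `K` vanishes by the choice of `t`. This
    -- replaces a Lagrange multiplier argument.
    let K : E → ℝ := fun z => 1 / p * ‖z‖ ^ p - 1 / (2 * γ) * (S * (‖z‖ ^ p) ^ (2 * γ / p))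
    have hK' : HasFDerivAt K (0 : E →L[ℝ] ℝ) z₀ := by
      have h1 : HasDerivAt (fun s : ℝ => 1 / p * s - 1 / (2 * γ) * (S * s ^ (2 * γ / p))) 0
          (‖z₀‖ ^ p) := by
        have hs : 0 < t ^ p := rpow_pos_of_pos ht0 _
        rw [hnorm]
        have h2 := ((hasDerivAt_id (t ^ p)).const_mul (1 / p)).sub
          (((hasDerivAt_rpow_const (x := t ^ p) (p := 2 * γ / p) (Or.inl hs.ne')).const_mul
            S).const_mul (1 / (2 * γ)))
        refine h2.congr_deriv ?_
        have h3 : (t ^ p) ^ (2 * γ / p - 1) = S⁻¹ := by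
          rw [← rpow_mul ht0.le, ← htd]
          congr 1
          field_simp
        rw [h3]
        field_simp
        ring
      have := h1.comp_hasFDerivAt z₀ hN'
      rwa [zero_smul] at this
    have hmin : IsLocalMin (J - K) z₀ := by
      refine Filter.Eventually.of_forall fun w => ?_
      have e : ∀ w : E, (‖w‖ ^ p) ^ (2 * γ / p) = ‖w‖ ^ (2 * γ) := fun w => by
        rw [← rpow_mul (norm_nonneg w)]
        congr 1
        field_simp
      have h1 : (J - K) z₀ = 0 := by
        simp only [J, K, Pi.sub_apply, e, hBz₀, hnorm, hSt]
        ring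
      have h2 : (J - K) w = 1 / (2 * γ) * (S * ‖w‖ ^ (2 * γ) - B w) := by
        simp only [J, K, Pi.sub_apply, e]
        ring
      rw [h1, h2]
      exact mul_nonneg (by positivity) (sub_nonneg.2 (hBS w))
    have hzero := hmin.hasFDerivAt_eq_zero (hJ'.sub hK')
    rw [sub_zero] at hzero
    rwa [hzero] at hJ'
  have hc : 0 < 1 / p - 1 / (2 * γ) := sub_pos.2 (one_div_lt_one_div_of_lt hp hpγ)
  refine ⟨z₀, hne, hcrit, ?_, ?_⟩
  · rintro _ ⟨z, ⟨hz, J', hJ', hJz⟩, rfl⟩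
    have hz' := norm_pos_iff.2 hz
    -- The derivative along the ray is computed from `J'` and again from homogeneity; comparing the
    -- two gives `B z = ‖z‖^p`.
    have hray : HasDerivAt (fun s : ℝ => J (s • z)) 0 1 := by
      have h1 : HasDerivAt (fun s : ℝ => s • z) z 1 := by
        simpa using (hasDerivAt_id (1 : ℝ)).smul_const z
      have h2 : HasFDerivAt J J' ((1 : ℝ) • z) := by rwa [one_smul]
      have := h2.comp_hasDerivAt (1 : ℝ) h1
      rwa [hJz] at this
    have hray' : HasDerivAt (fun s : ℝ => J (s • z)) (‖z‖ ^ p - B z) 1 := by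
      have h1 : HasDerivAt (fun s : ℝ => 1 / p * (s ^ p * ‖z‖ ^ p) -
          1 / (2 * γ) * (s ^ (2 * γ) * B z)) (‖z‖ ^ p - B z) 1 := by
        have h2 := (((hasDerivAt_rpow_const (x := (1 : ℝ)) (p := p)
          (Or.inl one_ne_zero)).mul_const (‖z‖ ^ p)).const_mul (1 / p)).sub
          (((hasDerivAt_rpow_const (x := (1 : ℝ)) (p := 2 * γ)
            (Or.inl one_ne_zero)).mul_const (B z)).const_mul (1 / (2 * γ)))
        refine h2.congr_deriv ?_
        simp only [one_rpow]
        field_simp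
      refine h1.congr_of_eventuallyEq ?_
      filter_upwards [lt_mem_nhds one_pos] with s hs
      rw [hJ]
      simp only
      rw [hBhom s hs, norm_smul, norm_of_nonneg hs.le, mul_rpow hs.le (norm_nonneg _)]
    have hBz : B z = ‖z‖ ^ p := by linarith [hray'.unique hray]
    have h1 : S⁻¹ ≤ ‖z‖ ^ (2 * γ - p) := by
      rw [rpow_sub hz', le_div_iff₀ (by positivity), inv_mul_le_iff₀ hS, ← hBz]
      exact hBS z
    have h2 : t ≤ ‖z‖ := by
      rw [← htd] at h1
      exact (rpow_le_rpow_iff ht0.le hz'.le hd).1 h1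
    have h3 : t ^ p ≤ ‖z‖ ^ p := rpow_le_rpow ht0.le h2 hp.le
    simp only [hJ, hBz, hBz₀, hnorm, ← sub_mul]
    exact mul_le_mul_of_nonneg_left h3 hc.le
  · intro m hm
    exact hm ⟨z₀, ⟨hne, 0, hcrit, rfl⟩, rfl⟩

end Abstract

/-! ### The space of pairs -/

section Pair

open Real Filter Topology

variable {N : ℕ} {p : ℝ} {lam : ℝ≥0} {a b : LatticePoint N → ℝ≥0}

/-- The density of the `p`-th power of the norm of `W_λ`. -/
def pairDensity (p : ℝ) (lam : ℝ≥0) (a b : LatticePoint N → ℝ≥0) (w : LatticePoint N → ℝ × ℝ)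
    (x : LatticePoint N) : ℝ :=
  energyDensity p lam a (fun y => (w y).1) x + energyDensity p lam b (fun y => (w y).2) x

theorem pairDensity_nonneg (w : LatticePoint N → ℝ × ℝ) (x : LatticePoint N) :
    0 ≤ pairDensity p lam a b w x :=
  add_nonneg (energyDensity_nonneg _ _ _ _ _) (energyDensity_nonneg _ _ _ _ _)

theorem summable_left_right {w : LatticePoint N → ℝ × ℝ}
    (hw : Summable (pairDensity p lam a b w)) :
    Summable (energyDensity p lam a fun y => (w y).1) ∧
      Summable (energyDensity p lam b fun y => (w y).2) :=
  ⟨Summable.of_nonneg_of_le (energyDensity_nonneg _ _ _ _)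
    (fun x => le_add_of_nonneg_right (energyDensity_nonneg _ _ _ _ x)) hw,
   Summable.of_nonneg_of_le (energyDensity_nonneg _ _ _ _)
    (fun x => le_add_of_nonneg_left (energyDensity_nonneg _ _ _ _ x)) hw⟩

/-- The values and the differences along edges, weighted such that the `ℓ^p` norm of
`edgeFn p lam h u` is the norm of `u` in `W_{λ,h}`. -/
def edgeFn (p : ℝ) (lam : ℝ≥0) (h : LatticePoint N → ℝ≥0) (u : LatticePoint N → ℝ)
    (q : LatticePoint N × LatticePoint N) : ℝ :=
  if q.2 = q.1 then ((lam : ℝ) * h q.1 + 1) ^ (1 / p) * u q.1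
  else if q.2 ∈ neighbors q.1 then (1 / 2 : ℝ) ^ (1 / p) * (u q.2 - u q.1) else 0

theorem edgeFn_add (h : LatticePoint N → ℝ≥0) (u v : LatticePoint N → ℝ)
    (q : LatticePoint N × LatticePoint N) :
    edgeFn p lam h (u + v) q = edgeFn p lam h u q + edgeFn p lam h v q := by
  simp only [edgeFn, Pi.add_apply]
  split_ifs <;> ring

theorem edgeFn_smul (h : LatticePoint N → ℝ≥0) (r : ℝ) (u : LatticePoint N → ℝ)
    (q : LatticePoint N × LatticePoint N) :
    edgeFn p lam h (r • u) q = r * edgeFn p lam h u q := by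
  simp only [edgeFn, Pi.smul_apply, smul_eq_mul]
  split_ifs <;> ring

/-- Each term is at most the whole sum, so `f i ^ s ≤ f i * (∑ f)^{s-1}`. This is the source of the
embedding of `ℓ^p` into `ℓ^q` for `q ≥ p`. -/
theorem tsum_rpow_le_rpow_tsum {ι : Type*} {f : ι → ℝ} (hf : ∀ i, 0 ≤ f i) (hs : Summable f)
    {s : ℝ} (h1 : 1 ≤ s) :
    Summable (fun i => f i ^ s) ∧ ∑' i, f i ^ s ≤ (∑' i, f i) ^ s := by
  have h0 : 0 ≤ ∑' i, f i := tsum_nonneg hf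
  have le : ∀ i, f i ^ s ≤ f i * (∑' i, f i) ^ (s - 1) := fun i => by
    have hi : f i ≤ ∑' i, f i := hs.le_tsum i fun j _ => hf j
    calc f i ^ s = f i ^ (s - 1) * f i := (rpow_sub_one_mul_self (by linarith) (hf i)).symm
      _ ≤ (∑' i, f i) ^ (s - 1) * f i :=
          mul_le_mul_of_nonneg_right (rpow_le_rpow (hf i) hi (by linarith)) (hf i)
      _ = _ := mul_comm _ _
  have hsum := Summable.of_nonneg_of_le (fun i => rpow_nonneg (hf i) s) le (hs.mul_right _)
  refine ⟨hsum, (hsum.tsum_le_tsum le (hs.mul_right _)).trans_eq ?_⟩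
  rw [tsum_mul_right, mul_comm, rpow_sub_one_mul_self (by linarith) h0]

variable [hp : Fact (2 ≤ p)]

/-- The `ℝ²`-valued function underlying a pair. -/
def PairSpace.val (z : PairSpace p lam a b) (x : LatticePoint N) : ℝ × ℝ := (z.fst x, z.snd x)

theorem PairSpace.val_smul (r : ℝ) (z : PairSpace p lam a b) (x : LatticePoint N) :
    (r • z).val x = r • z.val x := rfl

/-- Writing `‖z‖^p` as a sum of nonnegative local terms lets the norm be split over a finite set and
its complement. -/
theorem PairSpace.hasSum (z : PairSpace p lam a b) :
    HasSum (pairDensity p lam a b z.val) (‖z‖ ^ p) := by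
  have hp0 : 0 < p := by linarith [hp.out]
  have htr : (ENNReal.ofReal p).toReal = p := ENNReal.toReal_ofReal hp0.le
  have e : ‖z‖ ^ p = ∑' x, energyDensity p lam a z.fst.fn x +
      ∑' x, energyDensity p lam b z.snd.fn x := by
    rw [WithLp.prod_norm_eq_add (by rw [htr]; exact hp0), htr, ← rpow_mul (by positivity),
      one_div_mul_cancel hp0.ne', rpow_one]
    congr 1
    · change ((∑' x, energyDensity p lam a z.fst.fn x) ^ (1 / p)) ^ p = _
      rw [← rpow_mul (tsum_nonneg (energyDensity_nonneg p lam a _)), one_div_mul_cancel hp0.ne',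
        rpow_one]
    · change ((∑' x, energyDensity p lam b z.snd.fn x) ^ (1 / p)) ^ p = _
      rw [← rpow_mul (tsum_nonneg (energyDensity_nonneg p lam b _)), one_div_mul_cancel hp0.ne',
        rpow_one]
  rw [e]
  exact z.fst.summable.hasSum.add z.snd.summable.hasSum

theorem mem_weightedSubmodule {h : LatticePoint N → ℝ≥0} {u : LatticePoint N → ℝ}
    (hu : Summable (energyDensity p lam h u)) : u ∈ weightedSubmodule p lam h := by
  refine ⟨Summable.of_nonneg_of_le (fun x => add_nonneg (gradPow_nonneg p u x) (by positivity))
    (fun x => ?_) hu, summable_of_energyDensity p lam h hu⟩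
  have h1 : 0 ≤ (lam : ℝ) * h x * |u x| ^ p := by positivity
  unfold energyDensity
  linarith

theorem PairSpace.exists_of_summable {w : LatticePoint N → ℝ × ℝ}
    (hw : Summable (pairDensity p lam a b w)) : ∃ z : PairSpace p lam a b, z.val = w :=
  ⟨WithLp.toLp _ (⟨_, mem_weightedSubmodule (summable_left_right hw).1⟩,
    ⟨_, mem_weightedSubmodule (summable_left_right hw).2⟩), rfl⟩

/-- Used with `m = 1` for the embeddings, and with large `m` away from the wells of the potential,
where it gains a factor `m⁻¹`. The norm on `ℝ × ℝ` is the maximum. -/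
theorem mul_norm_rpow_le_pairDensity {m : ℝ} (hm : 0 ≤ m) (w : LatticePoint N → ℝ × ℝ)
    {x : LatticePoint N} (ha : m ≤ lam * a x + 1) (hb : m ≤ lam * b x + 1) :
    m * ‖w x‖ ^ p ≤ pairDensity p lam a b w x := by
  have hp0 : 0 < p := by linarith [hp.out]
  have h1 : ‖w x‖ ^ p ≤ |(w x).1| ^ p + |(w x).2| ^ p := by
    rw [Prod.norm_def]
    rcases max_choice ‖(w x).1‖ ‖(w x).2‖ with h | h <;> rw [h]
    · exact le_add_of_nonneg_right (by positivity)
    · exact le_add_of_nonneg_left (by positivity)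
  have h2 := mul_le_mul_of_nonneg_right ha (by positivity : 0 ≤ |(w x).1| ^ p)
  have h3 := mul_le_mul_of_nonneg_right hb (by positivity : 0 ≤ |(w x).2| ^ p)
  have h4 := mul_le_mul_of_nonneg_left h1 hm
  have h5 := gradPow_nonneg p (fun y => (w y).1) x
  have h6 := gradPow_nonneg p (fun y => (w y).2) x
  unfold pairDensity energyDensity
  linarith

theorem norm_rpow_le_pairDensity (w : LatticePoint N → ℝ × ℝ) (x : LatticePoint N) :
    ‖w x‖ ^ p ≤ pairDensity p lam a b w x := by
  have h := mul_norm_rpow_le_pairDensity (p := p) (lam := lam) (a := a) (b := b) zero_le_one w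
    (x := x) (le_add_of_nonneg_left (by positivity)) (le_add_of_nonneg_left (by positivity))
  rwa [one_mul] at h

/-- The embedding of `W_λ` into `ℓ^q`, `q ≥ p`. -/
theorem PairSpace.exists_embedding {q : ℝ} (hpq : p ≤ q) [Fact (1 ≤ ENNReal.ofReal q)] :
    ∃ L : PairSpace p lam a b →L[ℝ] Ell (LatticePoint N) (ℝ × ℝ) q, ∀ z x, L z x = z.val x := by
  have hp0 : 0 < p := by linarith [hp.out]
  have hq0 : 0 < q := by linarith
  have key : ∀ z : PairSpace p lam a b, Summable (fun x => ‖z.val x‖ ^ q) ∧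
      ∑' x, ‖z.val x‖ ^ q ≤ ‖z‖ ^ q := by
    intro z
    have h1 : Summable fun x => ‖z.val x‖ ^ p :=
      Summable.of_nonneg_of_le (fun x => by positivity) (norm_rpow_le_pairDensity z.val)
        z.hasSum.summable
    have h2 : ∑' x, ‖z.val x‖ ^ p ≤ ‖z‖ ^ p := by
      rw [← z.hasSum.tsum_eq]
      exact h1.tsum_le_tsum (norm_rpow_le_pairDensity z.val) z.hasSum.summable
    have h3 := tsum_rpow_le_rpow_tsum (fun x => by positivity) h1 (s := q / p)
      ((one_le_div hp0).2 hpq)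
    have e : ∀ s : ℝ, 0 ≤ s → (s ^ p) ^ (q / p) = s ^ q := fun s hs => by
      rw [← rpow_mul hs]
      congr 1
      field_simp
    simp only [e _ (norm_nonneg _)] at h3
    refine ⟨h3.1, h3.2.trans ?_⟩
    rw [← e _ (norm_nonneg z)]
    exact rpow_le_rpow (tsum_nonneg fun x => by positivity) h2 (by positivity)
  let T : PairSpace p lam a b →ₗ[ℝ] Ell (LatticePoint N) (ℝ × ℝ) q :=
    { toFun := fun z => ⟨z.val, memEll hq0 (key z).1⟩
      map_add' := fun z w => rfl
      map_smul' := fun r z => rfl }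
  refine ⟨T.mkContinuous 1 fun z => ?_, fun z x => rfl⟩
  rw [one_mul]
  exact Ell.norm_le hq0 (norm_nonneg z) (key z).2

theorem hasSum_edgeFn_row (h : LatticePoint N → ℝ≥0) (u : LatticePoint N → ℝ)
    (x : LatticePoint N) :
    HasSum (fun y => |edgeFn p lam h u (x, y)| ^ p) (energyDensity p lam h u x) := by
  have hp0 : p ≠ 0 := by linarith [hp.out]
  have e : energyDensity p lam h u x =
      ∑ y ∈ insert x (neighbors x), |edgeFn p lam h u (x, y)| ^ p := by
    rw [Finset.sum_insert (self_notMem_neighbors x), energyDensity, gradPow, add_comm,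
      Finset.mul_sum]
    congr 1
    · have hw : (0 : ℝ) ≤ (lam : ℝ) * h x + 1 := by positivity
      simp only [edgeFn, if_true]
      rw [abs_mul, mul_rpow (abs_nonneg _) (abs_nonneg _), abs_of_nonneg (rpow_nonneg hw _),
        ← rpow_mul hw, one_div_mul_cancel hp0, rpow_one]
    · refine Finset.sum_congr rfl fun y hy => ?_
      have hyx : y ≠ x := fun e => self_notMem_neighbors x (e ▸ hy)
      simp only [edgeFn, if_neg hyx, if_pos hy]
      rw [abs_mul, mul_rpow (abs_nonneg _) (abs_nonneg _),
        abs_of_nonneg (rpow_nonneg (by norm_num) _), ← rpow_mul (by norm_num),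
        one_div_mul_cancel hp0, rpow_one]
  rw [e]
  refine hasSum_sum_of_ne_finset_zero fun y hy => ?_
  rw [Finset.mem_insert, not_or] at hy
  simp [edgeFn, if_neg hy.1, if_neg hy.2, zero_rpow hp0]

theorem hasSum_edgeFn {h : LatticePoint N → ℝ≥0} {u : LatticePoint N → ℝ}
    (hu : Summable (energyDensity p lam h u)) :
    HasSum (fun q => |edgeFn p lam h u q| ^ p) (∑' x, energyDensity p lam h u x) := by
  have hrow := hasSum_edgeFn_row (p := p) (lam := lam) h u
  have hs : Summable fun q => |edgeFn p lam h u q| ^ p := by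
    refine (summable_prod_of_nonneg fun q => by positivity).2 ⟨fun x => (hrow x).summable, ?_⟩
    simpa only [(hrow _).tsum_eq] using hu
  have := hs.hasSum
  rwa [hs.tsum_prod, tsum_congr fun x => (hrow x).tsum_eq] at this

theorem contDiff_abs_rpow_add : ContDiff ℝ 1 fun v : ℝ × ℝ => |v.1| ^ p + |v.2| ^ p := by
  have h := contDiff_norm_rpow (E := ℝ) (p := p) (by linarith [hp.out])
  exact (h.comp contDiff_fst).add (h.comp contDiff_snd)

/-- The `p`-th power of the norm of `W_λ` is Fréchet differentiable. -/
theorem PairSpace.exists_hasFDerivAt_norm_rpow (z : PairSpace p lam a b) :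
    ∃ N' : PairSpace p lam a b →L[ℝ] ℝ, HasFDerivAt (fun z => ‖z‖ ^ p) N' z := by
  have hp0 : 0 < p := by linarith [hp.out]
  -- The map `z ↦ ‖z‖^p` is treated as a linear map into `ℓ^p`, then a homogeneous superposition
  -- into `ℓ^1`, then summation. Writing `p * 1` matches `exists_superposition` with degree `p` and
  -- `r = 1`.
  have hp1 : 0 < p * 1 := by linarith
  have i1 : Fact (1 ≤ ENNReal.ofReal 1) := ⟨by simp⟩
  have i2 : Fact (1 ≤ ENNReal.ofReal (p * 1)) := ⟨by rw [mul_one]; exact (fact_one_le_ofReal p).out⟩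
  have hsum := fun z : PairSpace p lam a b =>
    (hasSum_edgeFn z.fst.summable).add (hasSum_edgeFn z.snd.summable)
  have hnorm : ∀ z : PairSpace p lam a b, ∑' x, energyDensity p lam a z.fst.fn x +
      ∑' x, energyDensity p lam b z.snd.fn x = ‖z‖ ^ p := fun z =>
    (z.fst.summable.hasSum.add z.snd.summable.hasSum).unique z.hasSum
  simp only [hnorm] at hsum
  have hle : ∀ (z : PairSpace p lam a b) (q : LatticePoint N × LatticePoint N),
      ‖(edgeFn p lam a z.fst.fn q, edgeFn p lam b z.snd.fn q)‖ ^ (p * 1) ≤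
        |edgeFn p lam a z.fst.fn q| ^ p + |edgeFn p lam b z.snd.fn q| ^ p := by
    intro z q
    rw [mul_one, Prod.norm_def]
    rcases max_choice ‖edgeFn p lam a z.fst.fn q‖ ‖edgeFn p lam b z.snd.fn q‖ with h | h <;> rw [h]
    · exact le_add_of_nonneg_right (by positivity)
    · exact le_add_of_nonneg_left (by positivity)
  have hmem : ∀ z : PairSpace p lam a b, Summable fun q : LatticePoint N × LatticePoint N =>
      ‖(edgeFn p lam a z.fst.fn q, edgeFn p lam b z.snd.fn q)‖ ^ (p * 1) := fun z =>
    Summable.of_nonneg_of_le (fun q => by positivity) (hle z) (hsum z).summable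
  let T : PairSpace p lam a b →ₗ[ℝ] Ell (LatticePoint N × LatticePoint N) (ℝ × ℝ) (p * 1) :=
    { toFun := fun z => ⟨fun q => (edgeFn p lam a z.fst.fn q, edgeFn p lam b z.snd.fn q),
        memEll hp1 (hmem z)⟩
      map_add' := fun z w => lp.ext (funext fun q =>
        Prod.ext (edgeFn_add a z.fst.fn w.fst.fn q) (edgeFn_add b z.snd.fn w.snd.fn q))
      map_smul' := fun r z => lp.ext (funext fun q =>
        Prod.ext (edgeFn_smul a r z.fst.fn q) (edgeFn_smul b r z.snd.fn q)) }
  let T' := T.mkContinuous 1 fun z => by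
    rw [one_mul]
    refine Ell.norm_le hp1 (norm_nonneg z) ?_
    have h := (hmem z).tsum_le_tsum (hle z) (hsum z).summable
    rw [(hsum z).tsum_eq] at h
    refine h.trans_eq ?_
    rw [mul_one]
  obtain ⟨Φ, hΦ, hΦ'⟩ := exists_superposition (ι := LatticePoint N × LatticePoint N)
    (γ := p) (r := 1) (by linarith [hp.out]) le_rfl (contDiff_abs_rpow_add (p := p)) (by
      intro t ht v
      simp only [Prod.smul_fst, Prod.smul_snd, smul_eq_mul, abs_mul, abs_of_pos ht]
      rw [mul_rpow ht.le (abs_nonneg _), mul_rpow ht.le (abs_nonneg _), mul_add])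
  have hs1 : ∀ f : Ell (LatticePoint N × LatticePoint N) ℝ 1, Summable fun q => ‖f q‖ := fun f => by
    simpa only [rpow_one] using f.summable one_pos
  let total : Ell (LatticePoint N × LatticePoint N) ℝ 1 →ₗ[ℝ] ℝ :=
    { toFun := fun f => ∑' q, f q
      map_add' := fun f g => (hs1 f).of_norm.tsum_add (hs1 g).of_norm
      map_smul' := fun r f => tsum_mul_left }
  let totalCLM := total.mkContinuous 1 fun f => by
    rw [one_mul]
    refine (norm_tsum_le_tsum_norm (hs1 f)).trans_eq ?_
    simpa only [rpow_one] using (f.norm_rpow one_pos).symm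
  obtain ⟨Φ', h'⟩ := hΦ' (T' z)
  refine ⟨totalCLM.comp (Φ'.comp T'), ?_⟩
  have hcomp := totalCLM.hasFDerivAt.comp z (h'.comp z T'.hasFDerivAt)
  refine hcomp.congr_of_eventuallyEq (Filter.Eventually.of_forall fun w => ?_)
  change _ = ∑' q, Φ (T' w) q
  simp only [hΦ]
  exact (hsum w).tsum_eq.symm

end Pair

/-! ### Maximizers of the nonlocal energy on the unit sphere -/

section Maximizer

open Real Filter Topology

theorem tendsto_pairDensity {N : ℕ} {p : ℝ} (hp : 0 ≤ p) {lam : ℝ≥0} {a b : LatticePoint N → ℝ≥0}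
    {κ : Type*} {l : Filter κ} {w : κ → LatticePoint N → ℝ × ℝ} {w₀ : LatticePoint N → ℝ × ℝ}
    (hw : ∀ x, Tendsto (fun n => w n x) l (𝓝 (w₀ x))) (x : LatticePoint N) :
    Tendsto (fun n => pairDensity p lam a b (w n) x) l (𝓝 (pairDensity p lam a b w₀ x)) := by
  have h1 := fun x => (continuous_fst.tendsto _).comp (hw x)
  have h2 := fun x => (continuous_snd.tendsto _).comp (hw x)
  have key : ∀ (h : LatticePoint N → ℝ≥0) {u : κ → LatticePoint N → ℝ} {u₀ : LatticePoint N → ℝ},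
      (∀ x, Tendsto (fun n => u n x) l (𝓝 (u₀ x))) →
        Tendsto (fun n => energyDensity p lam h (u n) x) l (𝓝 (energyDensity p lam h u₀ x)) := by
    intro h u u₀ hu
    unfold energyDensity gradPow
    exact ((tendsto_finsetSum _ fun y _ => (((hu y).sub (hu x)).abs.rpow_const
      (Or.inr hp))).const_mul _).add (((hu x).abs.rpow_const (Or.inr hp)).const_mul _)
  exact (key a h1).add (key b h2)

/-- A local version of the embedding into `ℓ^{γr}`, for a function `F` of growth `γ`. -/
theorem tsum_rpow_comp_le {ι : Type*} {p r γ C m : ℝ} (hp : 0 < p) (hr : 0 < r)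
    (hpq : p ≤ γ * r) (hC : 0 ≤ C) (hm : 0 < m) {F : ℝ × ℝ → ℝ} (hF0 : ∀ v, 0 ≤ F v)
    (hFb : ∀ v, F v ≤ C * ‖v‖ ^ γ) {w : ι → ℝ × ℝ} {e : ι → ℝ} (he : Summable e)
    (hwe : ∀ i, m * ‖w i‖ ^ p ≤ e i) :
    Summable (fun i => F (w i) ^ r) ∧
      ∑' i, F (w i) ^ r ≤ C ^ r * (m⁻¹ * ∑' i, e i) ^ (γ * r / p) := by
  have hle : ∀ i, ‖w i‖ ^ p ≤ m⁻¹ * e i := fun i => by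
    rw [le_inv_mul_iff₀ hm]
    exact hwe i
  have h1 : Summable fun i => ‖w i‖ ^ p :=
    Summable.of_nonneg_of_le (fun i => by positivity) hle (he.mul_left _)
  have h2 : ∑' i, ‖w i‖ ^ p ≤ m⁻¹ * ∑' i, e i := by
    rw [← tsum_mul_left]
    exact h1.tsum_le_tsum hle (he.mul_left _)
  obtain ⟨h3, h4⟩ := tsum_rpow_le_rpow_tsum (fun i => by positivity) h1 (s := γ * r / p)
    ((one_le_div hp).2 hpq)
  have hFle : ∀ i, F (w i) ^ r ≤ C ^ r * (‖w i‖ ^ p) ^ (γ * r / p) := fun i => by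
    rw [← rpow_mul (norm_nonneg _), mul_div_cancel₀ _ hp.ne', rpow_mul (norm_nonneg _),
      ← mul_rpow hC (by positivity)]
    exact rpow_le_rpow (hF0 _) (hFb _) hr.le
  have h5 := Summable.of_nonneg_of_le (fun i => rpow_nonneg (hF0 (w i)) r) hFle (h3.mul_left _)
  refine ⟨h5, (h5.tsum_le_tsum hFle (h3.mul_left _)).trans ?_⟩
  rw [tsum_mul_left]
  have h6 : 0 ≤ γ * r / p := div_nonneg (by linarith) hp.le
  gcongr
  exact h4.trans (rpow_le_rpow (tsum_nonneg fun i => by positivity) h2 h6)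

variable {N : ℕ} {p : ℝ} [hp : Fact (2 ≤ p)] {lam : ℝ≥0} {a b : LatticePoint N → ℝ≥0}

/-- An ultrafilter replaces a diagonal subsequence; the norm bound passes to the limit on finite
sets first, as in Fatou's lemma. -/
theorem exists_pointwise_limit {z : ℕ → PairSpace p lam a b} (hz : ∀ n, ‖z n‖ ≤ 1)
    (l : Ultrafilter ℕ) : ∃ z₀ : PairSpace p lam a b, ‖z₀‖ ≤ 1 ∧
      ∀ x, Tendsto (fun n => (z n).val x) l (𝓝 (z₀.val x)) := by
  have hp0 : 0 < p := by linarith [hp.out]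
  have hz1 : ∀ n, ‖z n‖ ^ p ≤ 1 := fun n => rpow_le_one (norm_nonneg _) (hz n) hp0.le
  have hbd : ∀ x n, (z n).val x ∈ Metric.closedBall (0 : ℝ × ℝ) 1 := by
    intro x n
    rw [mem_closedBall_zero_iff]
    have h1 := (norm_rpow_le_pairDensity (p := p) (lam := lam) (a := a) (b := b) (z n).val x).trans
      ((le_hasSum (z n).hasSum x fun y _ => pairDensity_nonneg _ y).trans (hz1 n))
    by_contra! h2
    exact absurd h1 (not_le.2 (one_lt_rpow h2 hp0))
  have hlim : ∀ x, ∃ v, Tendsto (fun n => (z n).val x) l (𝓝 v) := by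
    intro x
    obtain ⟨v, -, hv⟩ := (isCompact_closedBall (0 : ℝ × ℝ) 1).ultrafilter_le_nhds
      (l.map fun n => (z n).val x) 
        (tendsto_principal.2 (Filter.Eventually.of_forall (hbd x)))
    exact ⟨v, hv⟩
  choose w hw using hlim
  have hfin : ∀ S : Finset (LatticePoint N), ∑ x ∈ S, pairDensity p lam a b w x ≤ 1 := by
    intro S
    refine le_of_tendsto (tendsto_finsetSum S fun x _ => tendsto_pairDensity hp0.le hw x)
      (Filter.Eventually.of_forall fun n => ?_)
    exact (sum_le_hasSum S (fun x _ => pairDensity_nonneg _ x) (z n).hasSum).trans (hz1 n)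
  have hs := summable_of_sum_le (pairDensity_nonneg w) hfin
  obtain ⟨z₀, rfl⟩ := PairSpace.exists_of_summable hs
  refine ⟨z₀, ?_, hw⟩
  have h1 : ‖z₀‖ ^ p ≤ 1 := by
    rw [← z₀.hasSum.tsum_eq]
    exact hs.tsum_le_of_sum_le hfin
  by_contra! h2
  exact absurd h1 (not_le.2 (one_lt_rpow h2 hp0))

theorem rpow_abs_sub_le {x y r : ℝ} (hx : 0 ≤ x) (hy : 0 ≤ y) (hr : 0 ≤ r) :
    |x - y| ^ r ≤ x ^ r + y ^ r := by
  have h : |x - y| ≤ max x y := by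
    rw [abs_le]
    constructor
    · linarith [le_max_right x y]
    · linarith [le_max_left x y]
  refine (rpow_le_rpow (abs_nonneg _) h hr).trans ?_
  rcases max_choice x y with h | h <;> rw [h]
  · exact le_add_of_nonneg_right (rpow_nonneg hy _)
  · exact le_add_of_nonneg_left (rpow_nonneg hx _)

/-- Concentration is excluded if the potential is large outside a finite set. -/
theorem exists_maximizer {r γ C m S₀ : ℝ} (hr : 1 < r) [Fact (1 ≤ ENNReal.ofReal r)]
    (hpq : p ≤ γ * r) (hpγ : p ≤ 2 * γ) (hC : 0 ≤ C) {F : ℝ × ℝ → ℝ} (hFc : Continuous F)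
    (hF0 : ∀ v, 0 ≤ F v) (hFb : ∀ v, F v ≤ C * ‖v‖ ^ γ)
    {D : Ell (LatticePoint N) ℝ r →L[ℝ] Ell (LatticePoint N) ℝ r →L[ℝ] ℝ}
    (hD : ∀ f g, D f g = D g f) {f : PairSpace p lam a b → Ell (LatticePoint N) ℝ r}
    (hf : ∀ z x, f z x = F (z.val x))
    (hhom : ∀ t : ℝ, 0 < t → ∀ z, D (f (t • z)) (f (t • z)) = t ^ (2 * γ) * D (f z) (f z))
    {Ω : Finset (LatticePoint N)} (hm : 1 ≤ m)
    (hΩ : ∀ x ∉ Ω, m ≤ lam * a x + 1 ∧ m ≤ lam * b x + 1) (hS₀ : 0 < S₀)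
    (hlow : ∃ z, ‖z‖ ≤ 1 ∧ S₀ ≤ D (f z) (f z)) (hsmall : ‖D‖ * C ^ 2 * m⁻¹ ≤ S₀ / 2) :
    ∃ S, 0 < S ∧ (∀ z, D (f z) (f z) ≤ S * ‖z‖ ^ (2 * γ)) ∧ ∃ z, ‖z‖ = 1 ∧ D (f z) (f z) = S := by
  have hp0 : 0 < p := by linarith [hp.out]
  have hr0 : 0 < r := by linarith
  have hγ : 0 < γ := by linarith
  have hm0 : 0 < m := by linarith
  set B : PairSpace p lam a b → ℝ := fun z => D (f z) (f z) with hB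
  have hquad : ∀ g : Ell (LatticePoint N) ℝ r, D g g ≤ ‖D‖ * ‖g‖ ^ 2 := fun g => by
    rw [sq, ← mul_assoc]
    exact (le_abs_self _).trans (D.le_opNorm₂ g g)
  have hfabs : ∀ z x, ‖f z x‖ ^ r = F (z.val x) ^ r := fun z x => by
    rw [hf, norm_of_nonneg (hF0 _)]
  have hz1 : ∀ z : PairSpace p lam a b, ‖z‖ ≤ 1 → ‖z‖ ^ p ≤ 1 := fun z hz =>
    rpow_le_one (norm_nonneg _) hz hp0.le
  have hfnorm : ∀ z : PairSpace p lam a b, ‖z‖ ≤ 1 → ‖f z‖ ≤ C := by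
    intro z hz
    refine Ell.norm_le hr0 hC ?_
    simp only [hfabs]
    refine (tsum_rpow_comp_le hp0 hr0 hpq hC one_pos hF0 hFb z.hasSum.summable fun x => by
      rw [one_mul]; exact norm_rpow_le_pairDensity z.val x).2.trans ?_
    rw [z.hasSum.tsum_eq, inv_one, one_mul]
    refine mul_le_of_le_one_right (by positivity) (rpow_le_one (by positivity) (hz1 z hz) ?_)
    positivity
  -- The ball, unlike the sphere, is closed under pointwise limits; `‖z₀‖ = 1` is recovered at the
  -- end.
  set S := sSup (B '' {z | ‖z‖ ≤ 1}) with hS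
  have hbdd : BddAbove (B '' {z | ‖z‖ ≤ 1}) := by
    refine ⟨‖D‖ * C ^ 2, ?_⟩
    rintro _ ⟨z, hz, rfl⟩
    refine (hquad _).trans ?_
    gcongr
    exact hfnorm z hz
  obtain ⟨z₂, hz₂, hz₂S⟩ := hlow
  have hS₀S : S₀ ≤ S := hz₂S.trans (le_csSup hbdd ⟨z₂, hz₂, rfl⟩)
  have hSpos : 0 < S := hS₀.trans_le hS₀S
  have hF00 : F 0 = 0 := by
    refine le_antisymm ((hFb 0).trans ?_) (hF0 0)
    rw [norm_zero, zero_rpow hγ.ne', mul_zero]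
  have hBS : ∀ z, B z ≤ S * ‖z‖ ^ (2 * γ) := by
    intro z
    rcases eq_or_ne z 0 with rfl | hz
    · have h0 : f 0 = 0 := lp.ext (funext fun x => by
        rw [hf]
        exact hF00)
      simp only [hB, h0, map_zero]
      positivity
    · have hz' := norm_pos_iff.2 hz
      have h1 : B z = ‖z‖ ^ (2 * γ) * B (‖z‖⁻¹ • z) := by
        rw [hB, ← hhom _ hz', smul_smul, mul_inv_cancel₀ hz'.ne', one_smul]
      rw [h1, mul_comm]
      refine mul_le_mul_of_nonneg_right (le_csSup hbdd ⟨_, ?_, rfl⟩) (by positivity)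
      simp only [Set.mem_ofPred_eq]
      rw [norm_smul, norm_inv, norm_norm, inv_mul_cancel₀ hz'.ne']
  refine ⟨S, hSpos, hBS, ?_⟩
  obtain ⟨c, -, hcS, hc⟩ := exists_seq_tendsto_sSup (S := B '' {z | ‖z‖ ≤ 1}) ⟨_, z₂, hz₂, rfl⟩ hbdd
  choose z hz hzc using hc
  have hBz : Tendsto (fun n => B (z n)) (hyperfilter ℕ : Filter ℕ) (𝓝 S) := by
    simp only [hzc]
    exact hcS.mono_left Nat.hyperfilter_le_atTop
  obtain ⟨z₀, hz₀, hlim⟩ := exists_pointwise_limit hz (hyperfilter ℕ)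
  set l : Filter ℕ := (hyperfilter ℕ : Filter ℕ) with hl
  set g : ℕ → Ell (LatticePoint N) ℝ r := fun n => f (z n) - f z₀ with hg
  have hgx : ∀ n x, g n x = F ((z n).val x) - F (z₀.val x) := fun n x => by
    rw [hg]
    simp only [lp.coeFn_sub, Pi.sub_apply, hf]
  have hg0 : ∀ x, Tendsto (fun n => g n x) l (𝓝 0) := by
    intro x
    simp only [hgx]
    have := ((hFc.tendsto _).comp (hlim x)).sub_const (F (z₀.val x))
    rwa [sub_self] at this
  have hweak : Tendsto (fun n => D (f z₀) (g n)) l (𝓝 0) := by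
    refine tendsto_functional_of_pointwise hr (D (f z₀)) (M := C + C) (fun n => ?_) hg0
    exact (norm_sub_le _ _).trans (add_le_add (hfnorm _ (hz n)) (hfnorm _ hz₀))
  -- Exact because `D` is bilinear and symmetric, so no Brezis–Lieb lemma is needed.
  have hsplit : ∀ n, B (z n) = B z₀ + 2 * D (f z₀) (g n) + D (g n) (g n) := by
    intro n
    have e : f (z n) = f z₀ + g n := (add_sub_cancel _ _).symm
    simp only [hB]
    rw [e]
    simp only [map_add, _root_.add_apply]
    rw [hD (g n) (f z₀)]
    ring
  have hpd := fun x => tendsto_pairDensity (p := p) (lam := lam) (a := a) (b := b) hp0.le hlim x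
  have hexp : 0 ≤ γ * r / p := by positivity
  -- On `K` the differences `g n` tend to 0. Off `K` the energy of `z n` is at most 1 minus its part
  -- on `K`, and the potential bound converts it into an `ℓ^p` bound with the factor `m⁻¹`. The
  -- limit in `n` is taken with `K` fixed; `hfinal` then exhausts the lattice.
  have hstep : ∀ K : Finset (LatticePoint N), Ω ⊆ K →
      S ≤ B z₀ + ‖D‖ * (C ^ r * (m⁻¹ * (1 - ∑ x ∈ K, pairDensity p lam a b z₀.val x)) ^ (γ * r / p)
        + ∑' x : { x // x ∉ K }, ‖f z₀ x‖ ^ r) ^ (2 / r) := by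
    intro K hK
    have htail : ∀ n, ‖g n‖ ^ r ≤ ∑ x ∈ K, ‖g n x‖ ^ r +
        (C ^ r * (m⁻¹ * (1 - ∑ x ∈ K, pairDensity p lam a b (z n).val x)) ^ (γ * r / p)
          + ∑' x : { x // x ∉ K }, ‖f z₀ x‖ ^ r) := by
      intro n
      have hsub := fun g : Ell (LatticePoint N) ℝ r =>
        ((g.summable hr0).comp_injective (Subtype.val_injective (p := fun x => x ∉ K)))
      rw [(g n).norm_rpow hr0, ← ((g n).summable hr0).sum_add_tsum_subtype_compl K]
      gcongr
      have hle : ∀ x : { x // x ∉ K }, ‖g n x‖ ^ r ≤ ‖f (z n) x‖ ^ r + ‖f z₀ x‖ ^ r := fun x => by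
        rw [hgx, hfabs, hfabs]
        exact rpow_abs_sub_le (hF0 _) (hF0 _) hr0.le
      refine ((hsub (g n)).tsum_le_tsum hle ((hsub _).add (hsub _))).trans ?_
      refine ((hsub (f (z n))).tsum_add (hsub (f z₀))).trans_le ?_
      refine add_le_add ?_ le_rfl
      have hes : Summable fun x : { x // x ∉ K } => pairDensity p lam a b (z n).val x :=
        (z n).hasSum.summable.comp_injective Subtype.val_injective
      have h1 := (tsum_rpow_comp_le (w := fun x : { x // x ∉ K } => (z n).val x) hp0 hr0 hpq hC hm0
        hF0 hFb hes fun x => mul_norm_rpow_le_pairDensity hm0.le (z n).val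
          (hΩ x fun hx => x.2 (hK hx)).1 (hΩ x fun hx => x.2 (hK hx)).2).2
      have h2 : ∑' x : { x // x ∉ K }, pairDensity p lam a b (z n).val x ≤
          1 - ∑ x ∈ K, pairDensity p lam a b (z n).val x := by
        have h3 := (z n).hasSum.summable.sum_add_tsum_subtype_compl K
        rw [(z n).hasSum.tsum_eq] at h3
        linarith [hz1 _ (hz n)]
      calc ∑' x : { x // x ∉ K }, ‖f (z n) x‖ ^ r = ∑' x : { x // x ∉ K }, F ((z n).val x) ^ r :=
            tsum_congr fun x => hfabs _ _
        _ ≤ _ := h1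
        _ ≤ _ := by
            have h4 : 0 ≤ ∑' x : { x // x ∉ K }, pairDensity p lam a b (z n).val x :=
              tsum_nonneg fun x => pairDensity_nonneg _ _
            gcongr
    have hbound : ∀ n, B (z n) ≤ B z₀ + 2 * D (f z₀) (g n) + ‖D‖ * (∑ x ∈ K, ‖g n x‖ ^ r +
        (C ^ r * (m⁻¹ * (1 - ∑ x ∈ K, pairDensity p lam a b (z n).val x)) ^ (γ * r / p)
          + ∑' x : { x // x ∉ K }, ‖f z₀ x‖ ^ r)) ^ (2 / r) := by
      intro n
      rw [hsplit]
      have h1 : ‖g n‖ ^ 2 = (‖g n‖ ^ r) ^ (2 / r) := by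
        rw [← rpow_mul (norm_nonneg _), mul_div_cancel₀ _ hr0.ne']
        norm_cast
      have h2 := (hquad (g n)).trans (mul_le_mul_of_nonneg_left (h1.trans_le
        (rpow_le_rpow (rpow_nonneg (norm_nonneg _) _) (htail n)
          (by positivity : 0 ≤ 2 / r))) (norm_nonneg D))
      linarith
    have hT1 : Tendsto (fun n => ∑ x ∈ K, ‖g n x‖ ^ r) l (𝓝 0) := by
      have := tendsto_finsetSum K fun x _ => (hg0 x).norm.rpow_const (p := r) (Or.inr hr0.le)
      simpa [zero_rpow hr0.ne'] using this
    have hT2 : Tendsto (fun n => ∑ x ∈ K, pairDensity p lam a b (z n).val x) l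
        (𝓝 (∑ x ∈ K, pairDensity p lam a b z₀.val x)) :=
      tendsto_finsetSum K fun x _ => hpd x
    have hT3 := (((((hT2.const_sub 1).const_mul m⁻¹).rpow_const (p := γ * r / p)
      (Or.inr hexp)).const_mul (C ^ r)).add_const (∑' x : { x // x ∉ K }, ‖f z₀ x‖ ^ r))
    have hT4 := (((hT1.add hT3).rpow_const (p := 2 / r) (Or.inr (by positivity))).const_mul ‖D‖)
    have hT5 := ((hweak.const_mul 2).const_add (B z₀)).add hT4
    rw [mul_zero, add_zero, zero_add] at hT5
    exact le_of_tendsto_of_tendsto' hBz hT5 hbound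
  have hfinal : S ≤ B z₀ + ‖D‖ * (C ^ r * (m⁻¹ * (1 - ‖z₀‖ ^ p)) ^ (γ * r / p) + 0) ^ (2 / r) := by
    have h1 : Tendsto (fun K : Finset (LatticePoint N) =>
        ∑ x ∈ K, pairDensity p lam a b z₀.val x) atTop (𝓝 (‖z₀‖ ^ p)) := z₀.hasSum
    have h2 := tendsto_tsum_compl_atTop_zero fun x => ‖f z₀ x‖ ^ r
    have h3 := (((((((h1.const_sub 1).const_mul m⁻¹).rpow_const (p := γ * r / p)
      (Or.inr hexp)).const_mul (C ^ r)).add h2).rpow_const (p := 2 / r)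
        (Or.inr (by positivity))).const_mul ‖D‖).const_add (B z₀)
    refine ge_of_tendsto h3 ?_
    filter_upwards [eventually_ge_atTop Ω] with K hK using hstep K hK
  have hs0 : 0 ≤ ‖z₀‖ ^ p := by positivity
  have hs1 : ‖z₀‖ ^ p ≤ 1 := hz1 _ hz₀
  have hq : 1 ≤ 2 * γ / p := (one_le_div hp0).2 hpγ
  have hθ0 : 0 ≤ m⁻¹ * (1 - ‖z₀‖ ^ p) := mul_nonneg (by positivity) (by linarith)
  have hθ1 : m⁻¹ * (1 - ‖z₀‖ ^ p) ≤ 1 :=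
    mul_le_one₀ (inv_le_one_of_one_le₀ hm) (by linarith) (by linarith)
  have e1 : (C ^ r * (m⁻¹ * (1 - ‖z₀‖ ^ p)) ^ (γ * r / p) + 0) ^ (2 / r) =
      C ^ 2 * (m⁻¹ * (1 - ‖z₀‖ ^ p)) ^ (2 * γ / p) := by
    rw [add_zero, mul_rpow (by positivity) (by positivity), ← rpow_mul hC, ← rpow_mul hθ0,
      mul_div_cancel₀ _ hr0.ne']
    congr 1
    · norm_cast
    · congr 1
      field_simp
  -- The base is at most 1 and the exponent at least 1. Making the bound linear also removes `p`
  -- from the condition on `m`.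
  have h1 : (m⁻¹ * (1 - ‖z₀‖ ^ p)) ^ (2 * γ / p) ≤ m⁻¹ * (1 - ‖z₀‖ ^ p) :=
    (rpow_le_rpow_of_exponent_ge' hθ0 hθ1 zero_le_one hq).trans_eq (rpow_one _)
  have h2 : ‖D‖ * (C ^ 2 * (m⁻¹ * (1 - ‖z₀‖ ^ p)) ^ (2 * γ / p)) ≤ S / 2 * (1 - ‖z₀‖ ^ p) := by
    calc _ ≤ ‖D‖ * (C ^ 2 * (m⁻¹ * (1 - ‖z₀‖ ^ p))) := by gcongr
      _ = ‖D‖ * C ^ 2 * m⁻¹ * (1 - ‖z₀‖ ^ p) := by ring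
      _ ≤ S / 2 * (1 - ‖z₀‖ ^ p) :=
          mul_le_mul_of_nonneg_right (by linarith) (by linarith)
  have h3 : ‖z₀‖ ^ (2 * γ) ≤ ‖z₀‖ ^ p :=
    rpow_le_rpow_of_exponent_ge' (norm_nonneg _) hz₀ hp0.le hpγ
  have h4 : B z₀ ≤ S * ‖z₀‖ ^ p := (hBS z₀).trans (mul_le_mul_of_nonneg_left h3 hSpos.le)
  rw [e1] at hfinal
  -- With `s = ‖z₀‖^p` the estimates give `S ≤ S s + (S/2)(1 - s)`, hence `s ≥ 1`.
  have h5 : ‖z₀‖ ^ p = 1 := by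
    refine le_antisymm hs1 ?_
    have : S / 2 * 1 ≤ S / 2 * ‖z₀‖ ^ p := by linarith
    exact le_of_mul_le_mul_left this (half_pos hSpos)
  refine ⟨z₀, ?_, le_antisymm (by linarith [h5 ▸ h4]) ?_⟩
  · exact (rpow_left_inj (norm_nonneg _) zero_le_one hp0.ne').1 (h5.trans (one_rpow p).symm)
  · rw [h5] at h2
    change S ≤ B z₀
    rw [h5] at hfinal
    linarith

end Maximizer

/-! ### A test function and the ground state -/

section Test

open Real

variable {N : ℕ} {p : ℝ} {lam : ℝ≥0}

theorem mem_neighbors_comm {x y : LatticePoint N} : y ∈ neighbors x ↔ x ∈ neighbors y := by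
  rw [mem_neighbors, mem_neighbors]
  simp only [abs_sub_comm]

/-- The bound depends on neither `λ` nor `p`: the weight `h` vanishes at the support, and `κ^p ≤ κ`
for `κ ≤ 1`. Only `x₀` and its `2N` neighbours carry energy. -/
theorem summable_energyDensity_single (hp : 1 ≤ p) {h : LatticePoint N → ℝ≥0}
    {x₀ : LatticePoint N} (hx₀ : h x₀ = 0) {s κ : ℝ} (hs : |s| ≤ κ) (hκ : κ ≤ 1) :
    Summable (energyDensity p lam h (Pi.single x₀ s)) ∧
      ∑' x, energyDensity p lam h (Pi.single x₀ s) x ≤ (2 * N + 1) * ((N + 1) * κ) := by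
  have hp0 : 0 < p := by linarith
  have hκ0 : 0 ≤ κ := (abs_nonneg s).trans hs
  set u : LatticePoint N → ℝ := Pi.single x₀ s with hu
  have hκp : κ ^ p ≤ κ := (rpow_le_rpow_of_exponent_ge' hκ0 hκ zero_le_one hp).trans_eq (rpow_one κ)
  have hpow : ∀ v : ℝ, |v| ≤ κ → |v| ^ p ≤ κ := fun v hv =>
    (rpow_le_rpow (abs_nonneg _) hv hp0.le).trans hκp
  have hle : ∀ x, energyDensity p lam h u x ≤ (N + 1) * κ := by
    intro x
    have h1 : gradPow p u x ≤ N * κ := by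
      have : ∑ y ∈ neighbors x, |u y - u x| ^ p ≤ (neighbors x).card • κ := by
        refine Finset.sum_le_card_nsmul _ _ _ fun y hy => hpow _ ?_
        have hyx : y ≠ x := fun e => self_notMem_neighbors x (e ▸ hy)
        by_cases hx : x = x₀
        · have hy0 : y ≠ x₀ := hx ▸ hyx
          simpa [hu, hx, Pi.single_eq_of_ne hy0] using hs
        · by_cases hy0 : y = x₀
          · simpa [hu, hy0, Pi.single_eq_of_ne hx] using hs
          · simpa [hu, Pi.single_eq_of_ne hx, Pi.single_eq_of_ne hy0] using hκ0
      rw [card_neighbors, nsmul_eq_mul] at this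
      push_cast at this
      unfold gradPow
      linarith
    have h2 : ((lam : ℝ) * h x + 1) * |u x| ^ p ≤ κ := by
      by_cases hx : x = x₀
      · subst hx
        rw [hx₀, NNReal.coe_zero, mul_zero, zero_add, one_mul]
        exact hpow _ (by simpa [hu] using hs)
      · rw [hu, Pi.single_eq_of_ne hx, abs_zero, zero_rpow hp0.ne', mul_zero]
        exact hκ0
    unfold energyDensity
    linarith
  have hzero : ∀ x ∉ insert x₀ (neighbors x₀), energyDensity p lam h u x = 0 := by
    intro x hx
    rw [Finset.mem_insert, not_or] at hx
    have hux : u x = 0 := Pi.single_eq_of_ne hx.1 _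
    have huy : ∀ y ∈ neighbors x, u y = 0 := fun y hy =>
      Pi.single_eq_of_ne (fun e : y = x₀ => hx.2 (mem_neighbors_comm.1 (by rwa [e] at hy))) _
    rw [energyDensity, gradPow, hux, abs_zero, zero_rpow hp0.ne', mul_zero, add_zero,
      Finset.sum_eq_zero fun y hy => by rw [huy y hy, sub_zero, abs_zero, zero_rpow hp0.ne'],
      mul_zero]
  have hsum : HasSum (energyDensity p lam h u) _ := hasSum_sum_of_ne_finset_zero hzero
  refine ⟨hsum.summable, ?_⟩
  rw [hsum.tsum_eq]
  refine (Finset.sum_le_card_nsmul _ _ _ fun x _ => hle x).trans_eq ?_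
  rw [Finset.card_insert_of_notMem (self_notMem_neighbors x₀), card_neighbors, nsmul_eq_mul]
  push_cast
  ring

theorem PairSpace.exists_single [hp : Fact (2 ≤ p)] {a b : LatticePoint N → ℝ≥0}
    {x₀ : LatticePoint N} (ha : a x₀ = 0) (hb : b x₀ = 0) {c : ℝ × ℝ}
    (hc : ‖c‖ ≤ (2 * (2 * N + 1) * (N + 1) : ℝ)⁻¹) :
    ∃ z : PairSpace p lam a b, ‖z‖ ≤ 1 ∧ z.val = Pi.single x₀ c := by
  have hp1 : 1 ≤ p := by linarith [hp.out]
  set κ : ℝ := (2 * (2 * N + 1) * (N + 1) : ℝ)⁻¹ with hκdef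
  have hN : (0 : ℝ) ≤ N := Nat.cast_nonneg N
  have hκ : κ ≤ 1 := inv_le_one_of_one_le₀ (by nlinarith)
  have e1 : (fun y => (Pi.single x₀ c : LatticePoint N → ℝ × ℝ) y |>.1) = Pi.single x₀ c.1 := by
    funext y
    by_cases hy : y = x₀
    · subst hy; simp
    · simp [Pi.single_eq_of_ne hy]
  have e2 : (fun y => (Pi.single x₀ c : LatticePoint N → ℝ × ℝ) y |>.2) = Pi.single x₀ c.2 := by
    funext y
    by_cases hy : y = x₀
    · subst hy; simp
    · simp [Pi.single_eq_of_ne hy]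
  obtain ⟨s1, b1⟩ := summable_energyDensity_single (lam := lam) hp1 ha
    ((norm_fst_le c).trans hc) hκ
  obtain ⟨s2, b2⟩ := summable_energyDensity_single (lam := lam) hp1 hb
    ((norm_snd_le c).trans hc) hκ
  have hs : HasSum (pairDensity p lam a b (Pi.single x₀ c))
      (∑' x, energyDensity p lam a (Pi.single x₀ c.1) x +
        ∑' x, energyDensity p lam b (Pi.single x₀ c.2) x) := by
    have := s1.hasSum.add s2.hasSum
    rwa [← e1, ← e2] at this ⊢
  obtain ⟨z, hz⟩ := PairSpace.exists_of_summable hs.summable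
  refine ⟨z, ?_, hz⟩
  have h1 : ‖z‖ ^ p ≤ 1 := by
    have h2 := z.hasSum
    rw [hz] at h2
    rw [h2.unique hs]
    -- `κ` is chosen so that each of the two components contributes at most one half.
    have h3 : (2 * N + 1) * ((N + 1) * κ) + (2 * N + 1) * ((N + 1) * κ) = 1 := by
      rw [hκdef]
      field_simp
      norm_num
    linarith
  by_contra! h2
  exact absurd h1 (not_le.2 (one_lt_rpow h2 (by linarith)))

end Test

/-! ### The Green form and ground states for fixed `p` -/

section GroundState

open Real

variable {N : ℕ} {α γ : ℝ}

/-- Absolute summability over pairs of points justifies both the exchange of variables, which gives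
symmetry, and the iterated sum in the energy. -/
theorem exists_greenForm (hα : 0 < α) (hαN : α < N)
    [Fact (1 ≤ ENNReal.ofReal (hlsExponent N α))] :
    ∃ D : Ell (LatticePoint N) ℝ (hlsExponent N α) →L[ℝ]
        Ell (LatticePoint N) ℝ (hlsExponent N α) →L[ℝ] ℝ,
      (∀ f g, HasSum (fun q : LatticePoint N × LatticePoint N => green α q.1 q.2 * f q.1 * g q.2)
        (D f g)) ∧
      (∀ f g, D f g = D g f) ∧
      ∀ f : Ell (LatticePoint N) ℝ (hlsExponent N α), ∑' x, greenConv α f x * f x = D f f := by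
  obtain ⟨C, hC, hb⟩ := exists_hls hα hαN
  obtain ⟨D, hD⟩ := exists_kernelForm (one_lt_hlsExponent hα hαN).le hC.le
    (fun x y => green_nonneg hα x y) fun f S hf => hb f S hf
  refine ⟨D, hD, fun f g => ?_, fun f => ?_⟩
  · have h1 := (Equiv.prodComm _ _).hasSum_iff.2 (hD g f)
    refine HasSum.unique ?_ h1
    convert hD f g using 2 with q
    simp only [Function.comp_apply, Equiv.prodComm_apply, Prod.fst_swap, Prod.snd_swap]
    rw [green_symm]
    ring
  · rw [← (hD f f).tsum_eq, (hD f f).summable.tsum_prod]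
    refine tsum_congr fun x => ?_
    rw [greenConv, ← tsum_mul_right]
    exact tsum_congr fun y => by ring

/-- For fixed `p`, a ground state exists as soon as the potential is large enough outside a finite
set, compared with the nonlocal energy of a test function. -/
theorem exists_isGroundState (hα : 0 < α) (hαN : α < N)
    [Fact (1 ≤ ENNReal.ofReal (hlsExponent N α))]
    {D : Ell (LatticePoint N) ℝ (hlsExponent N α) →L[ℝ]
      Ell (LatticePoint N) ℝ (hlsExponent N α) →L[ℝ] ℝ}
    (hDsum : ∀ f g, HasSum
      (fun q : LatticePoint N × LatticePoint N => green α q.1 q.2 * f q.1 * g q.2) (D f g))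
    (hDsymm : ∀ f g, D f g = D g f)
    (hDconv : ∀ f : Ell (LatticePoint N) ℝ (hlsExponent N α),
      ∑' x, greenConv α f x * f x = D f f)
    {F : ℝ × ℝ → ℝ} (hF : ContDiff ℝ 1 F) (hF0 : ∀ v, 0 ≤ F v)
    (hFhom : ∀ t : ℝ, 0 < t → ∀ v, F (t • v) = t ^ γ • F v) {C : ℝ} (hC : 0 ≤ C)
    (hFb : ∀ v, F v ≤ C * ‖v‖ ^ γ) {a b : LatticePoint N → ℝ≥0} {x₀ : LatticePoint N}
    (ha : a x₀ = 0) (hb : b x₀ = 0) {c : ℝ × ℝ}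
    (hc : ‖c‖ ≤ (2 * (2 * N + 1) * (N + 1) : ℝ)⁻¹) (hFc : 0 < F c) {Ω : Finset (LatticePoint N)}
    {m : ℝ} (hm : 1 ≤ m) {lam : ℝ≥0}
    (hΩ : ∀ x ∉ Ω, m ≤ lam * a x + 1 ∧ m ≤ lam * b x + 1)
    (hsmall : ‖D‖ * C ^ 2 * m⁻¹ ≤ green α x₀ x₀ * F c * F c / 2)
    (p : ℝ) [hp : Fact (2 ≤ p)] (hpq : p < γ * hlsExponent N α) :
    ∃ z : PairSpace p lam a b, IsGroundState α γ F z := by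
  have hp2 := hp.out
  have hp0 : 0 < p := by linarith
  have hr1 := one_lt_hlsExponent hα hαN
  -- Hence `p < γ r < 2γ`, so the nonlocal term has higher degree than the norm term.
  have hr2 : hlsExponent N α < 2 := by
    rw [hlsExponent, div_lt_iff₀ (by linarith)]
    linarith
  set r := hlsExponent N α with hr
  have hγ1 : 1 < γ := by nlinarith
  have hpγ : p < 2 * γ := by nlinarith
  have i1 : Fact (1 ≤ ENNReal.ofReal (γ * r)) := ⟨by rw [ENNReal.one_le_ofReal]; linarith⟩
  obtain ⟨L, hL⟩ := PairSpace.exists_embedding (p := p) (lam := lam) (a := a) (b := b) hpq.le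
  obtain ⟨Φ, hΦ, hΦ'⟩ := exists_superposition (ι := LatticePoint N) hγ1 hr1.le hF hFhom
  set f : PairSpace p lam a b → Ell (LatticePoint N) ℝ r := fun z => Φ (L z) with hfdef
  have hf : ∀ z x, f z x = F (z.val x) := fun z x => by rw [hfdef, hΦ, hL]
  have hhom : ∀ t : ℝ, 0 < t → ∀ z, D (f (t • z)) (f (t • z)) = t ^ (2 * γ) * D (f z) (f z) := by
    intro t ht z
    have e : f (t • z) = t ^ γ • f z := lp.ext (funext fun x => by
      rw [hf, PairSpace.val_smul, hFhom t ht, lp.coeFn_smul, Pi.smul_apply, hf])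
    rw [e]
    simp only [map_smul, smul_apply, smul_eq_mul]
    rw [← mul_assoc, ← rpow_add ht, two_mul]
  have hdiff : ∀ z, ∃ B' : PairSpace p lam a b →L[ℝ] ℝ,
      HasFDerivAt (fun z => D (f z) (f z)) B' z := by
    intro z
    obtain ⟨Φ', h'⟩ := hΦ' (L z)
    have h1 : HasFDerivAt f (Φ'.comp L) z := h'.comp z L.hasFDerivAt
    exact ⟨_, (D.hasFDerivAt.comp z h1).clm_apply h1⟩
  have hlow : ∃ z : PairSpace p lam a b, ‖z‖ ≤ 1 ∧
      green α x₀ x₀ * F c * F c ≤ D (f z) (f z) := by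
    obtain ⟨z, hz, hzval⟩ := PairSpace.exists_single (p := p) (lam := lam) ha hb hc
    refine ⟨z, hz, ?_⟩
    -- All terms are nonnegative, so the diagonal one alone bounds the form from below.
    have h1 := le_hasSum (hDsum (f z) (f z)) (x₀, x₀) fun q _ => by
      rw [hf, hf]
      exact mul_nonneg (mul_nonneg (green_nonneg hα _ _) (hF0 _)) (hF0 _)
    simpa only [hf, hzval, Pi.single_eq_same] using h1
  obtain ⟨S, hS, hBS, z₁, hz₁, hBz₁⟩ := exists_maximizer hr1 hpq.le hpγ.le hC hF.continuous hF0 hFb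
    hDsymm hf hhom hm hΩ (mul_pos (mul_pos (green_self_pos hα hαN x₀) hFc) hFc) hlow hsmall
  have henergy : (energy α γ F : PairSpace p lam a b → ℝ) =
      fun z => 1 / p * ‖z‖ ^ p - 1 / (2 * γ) * D (f z) (f z) := by
    funext z
    rw [energy, ← hDconv, show (f z : LatticePoint N → ℝ) = fun x => F (z.fst x, z.snd x) from
      funext (hf z)]
  obtain ⟨z, h1, h2, h3⟩ := exists_groundState_of_maximizer hp0 hpγ hS hhom hdiff
    PairSpace.exists_hasFDerivAt_norm_rpow hBS hz₁ hBz₁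
  refine ⟨z, ?_⟩
  unfold IsGroundState nehari
  rw [henergy]
  exact ⟨h1, h2, h3⟩

end GroundState

end Choquard

end

/-! ### Choice of `λ₀` uniformly in `p` -/

theorem theorem1p1 (N : ℕ) (α γ : ℝ) (hα : 0 < α) (hαN : α < N)
    (a b : Choquard.LatticePoint N → ℝ≥0)
    (ha : {x | a x = 0}.Nonempty ∧ Bornology.IsBounded {x | a x = 0})
    (hb : {x | b x = 0}.Nonempty ∧ Bornology.IsBounded {x | b x = 0})
    (hab : ({x | a x = 0} ∩ {x | b x = 0}).Nonempty ∧
      Bornology.IsBounded ({x | a x = 0} ∩ {x | b x = 0}))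
    (ha2 : ∃ M₁ : ℝ≥0, 0 < M₁ ∧ {x | a x ≤ M₁}.Finite ∧ {x | a x ≤ M₁}.Nonempty)
    (hb2 : ∃ M₂ : ℝ≥0, 0 < M₂ ∧ {x | b x ≤ M₂}.Finite ∧ {x | b x ≤ M₂}.Nonempty)
    (F : ℝ × ℝ → ℝ) (hF : ContDiff ℝ 1 F) (hF0 : ∀ z, 0 ≤ F z) (hFne : ∃ z, F z ≠ 0)
    (hFhom : ∀ t : ℝ, 0 < t → ∀ u v : ℝ, F (t * u, t * v) = t ^ γ * F (u, v)) :
    ∃ lam₀ : ℝ≥0, 0 < lam₀ ∧ ∀ lam : ℝ≥0, lam₀ ≤ lam → ∀ (p : ℝ) [Fact (2 ≤ p)],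
      ((N : ℝ) + α) * p / (2 * N) < γ →
        ∃ z : Choquard.PairSpace p lam a b, Choquard.IsGroundState α γ F z := by
  open Choquard in
  have hN : (0 : ℝ) < N := hα.trans hαN
  -- For `γ ≤ 1` no `p ≥ 2` is admissible. The split comes first because the growth constant `C`
  -- needs `γ > 0` and must be fixed before `p`.
  by_cases hγ : 1 < γ
  swap
  · refine ⟨1, one_pos, fun lam _ p hp hpγ => absurd ?_ hγ⟩
    have := hp.out
    refine lt_trans ?_ hpγ
    rw [one_lt_div (by positivity)]
    nlinarith
  have hhom : ∀ t : ℝ, 0 < t → ∀ v : ℝ × ℝ, F (t • v) = t ^ γ • F v :=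
    fun t ht v => hFhom t ht v.1 v.2
  have hr1 := one_lt_hlsExponent hα hαN
  have i1 : Fact (1 ≤ ENNReal.ofReal (hlsExponent N α)) :=
    ⟨by rw [ENNReal.one_le_ofReal]; exact hr1.le⟩
  obtain ⟨C, hC, hFb⟩ := exists_homogeneous_bound (by linarith : 0 < γ) hF.continuous hhom
  obtain ⟨D, hD, hDsymm, hDconv⟩ := exists_greenForm hα hαN
  obtain ⟨x₀, hax, hbx⟩ := hab.1
  obtain ⟨M₁, hM₁, hfin₁, -⟩ := ha2
  obtain ⟨M₂, hM₂, hfin₂, -⟩ := hb2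
  set M : ℝ≥0 := min M₁ M₂ with hMdef
  have hM : 0 < M := lt_min hM₁ hM₂
  obtain ⟨c, hc, hFc⟩ : ∃ c : ℝ × ℝ, ‖c‖ ≤ (2 * (2 * N + 1) * (N + 1) : ℝ)⁻¹ ∧ 0 < F c := by
    obtain ⟨v, hv⟩ := hFne
    set κ : ℝ := (2 * (2 * N + 1) * (N + 1) : ℝ)⁻¹ with hκ
    have hκ0 : 0 < κ := by positivity
    have ht : 0 < κ / (‖v‖ + 1) := by positivity
    refine ⟨(κ / (‖v‖ + 1)) • v, ?_, ?_⟩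
    · rw [norm_smul, Real.norm_of_nonneg ht.le, div_mul_eq_mul_div, div_le_iff₀ (by positivity)]
      exact mul_le_mul_of_nonneg_left (by linarith) hκ0.le
    · rw [hhom _ ht]
      exact mul_pos (Real.rpow_pos_of_pos ht _) ((hF0 v).lt_of_ne' hv)
  set S₀ : ℝ := green α x₀ x₀ * F c * F c with hS₀def
  have hS₀ : 0 < S₀ := mul_pos (mul_pos (green_self_pos hα hαN x₀) hFc) hFc
  have hQ : 0 ≤ 2 * (‖D‖ * C ^ 2) / (S₀ * M) := by positivity
  -- This ensures `‖D‖C² ≤ (S₀/2)λM`, which gives the smallness condition with `m = λM + 1`. The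
  -- added 1 only makes `λ₀` positive.
  refine ⟨Real.toNNReal (2 * (‖D‖ * C ^ 2) / (S₀ * M)) + 1, by positivity,
    fun lam hlam p hp hpγ => ?_⟩
  have hlam' : 2 * (‖D‖ * C ^ 2) / (S₀ * M) ≤ lam := by
    have h1 : Real.toNNReal (2 * (‖D‖ * C ^ 2) / (S₀ * M)) ≤ lam := le_trans (by simp) hlam
    exact Real.toNNReal_le_iff_le_coe.1 h1
  have hMpos : (0 : ℝ) < M := hM
  refine exists_isGroundState hα hαN hD hDsymm hDconv hF hF0 hhom hC.le
    (fun v => (le_abs_self _).trans (hFb v)) hax hbx hc hFc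
    (Ω := hfin₁.toFinset ∪ hfin₂.toFinset) (m := lam * M + 1)
    (le_add_of_nonneg_left (by positivity)) ?_ ?_ p ?_
  · intro x hx
    simp only [Finset.mem_union, Set.Finite.mem_toFinset, Set.mem_ofPred_eq, not_or, not_le] at hx
    have h1 : (M : ℝ) ≤ a x := NNReal.coe_le_coe.2 ((min_le_left _ _).trans hx.1.le)
    have h2 : (M : ℝ) ≤ b x := NNReal.coe_le_coe.2 ((min_le_right _ _).trans hx.2.le)
    constructor <;> gcongr
  · rw [div_le_iff₀ (by positivity)] at hlam'
    rw [← hS₀def, ← div_eq_mul_inv, div_le_iff₀ (by positivity)]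
    nlinarith
  -- The assumption on `γ` is equivalent to `p < γ r`.
  · rw [div_lt_iff₀ (by positivity)] at hpγ
    rw [hlsExponent, mul_div_assoc', lt_div_iff₀ (by linarith)]
    linarith
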